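/- **Theorem (eigenvector phase transition, multiplicative perturbation, rank one).** For each $n\ge 1$ let $X_n$ be an $n\times n$ real symmetric (or complex Hermitian) non-negative definite random matrix and $P_n$ an $n\times n$ real symmetric (respectively complex Hermitian) random matrix of rank one whose sole non-zero eigenvalue is $\theta$, where $\theta\neq 0$ is a real constant not depending on $n$. All matrices are defined on one probability space; for each $n$, $X_n$ and $P_n$ are independent and the law of at least one of them is invariant under conjugation by the orthogonal (respectively unitary) group. Assume that almost surely the empirical eigenvalue distribution $\frac1n\sum_{j}\delta_{\lambda_j(X_n)}$ converges weakly to a non-random compactly supported probability measure $\mu_X\neq\delta_0$, and that the smallest and largest eigenvalues of $X_n$ converge almost surely to $a:=\min\operatorname{supp}\mu_X$ and $b:=\max\operatorname{supp}\mu_X$. For real $z\notin[a,b]$ put $$T_{\mu_X}(z)=\int\frac{t}{z-t}\,\mathrm d\mu_X(t),$$ and let $T_{\mu_X}(a^-)=\lim_{z\uparrow a}T_{\mu_X}(z)\in[-\infty,0)$, $T_{\mu_X}(b^+)=\lim_{z\downarrow b}T_{\mu_X}(z)\in(0,+\infty]$, and likewise for the derivative $T'_{\mu_X}$. Suppose that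 $$\frac1\theta\notin\bigl(T_{\mu_X}(a^-),T_{\mu_X}(b^+)\bigr)\quad\text{and}\quad\begin{cases}T'_{\mu_X}(b^+)=-\infty&\text{if }\theta>0,\\ T'_{\mu_X}(a^-)=-\infty&\text{if }\theta<0.\end{cases}$$ If $\theta<0$, suppose moreover that $\theta>-1$ (so that $I_n+P_n$ is positive definite) and $\mu_X(\{0\})=0$; both hold automatically if $a>0$. Let $\widetilde X_n=X_n(I_n+P_n)$, whose eigenvalues are all real. Then almost surely the following holds: for every sequence $(\widetilde u_n)_{n\ge1}$ in which $\widetilde u_n$ is a unit-norm eigenvector of $\widetilde X_n$ associated with its largest eigenvalue if $\theta>0$, and with its smallest eigenvalue if $\theta<0$, the norm of the orthogonal projection of $\widetilde u_n$ onto $\ker(\theta I_n-P_n)$ tends to $0$ as $n\to\infty$. -/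

import Mathlib

open MeasureTheory ProbabilityTheory Filter Topology
open scoped ENNReal ComplexOrder

/-- The entrywise (product) sigma-algebra on square matrices; random matrices are measurable maps
into it. -/
instance matrixMeasurableSpace {𝕜 : Type*} [MeasurableSpace 𝕜] (n : ℕ) :
    MeasurableSpace (Matrix (Fin n) (Fin n) 𝕜) :=
  inferInstanceAs (MeasurableSpace (Fin n → Fin n → 𝕜))

/-- The law of the random matrix `X` is invariant under conjugation by the unitary group
(`𝕜 = ℂ`), which is the orthogonal group when `𝕜 = ℝ`. -/
def ConjInvariant {𝕜 Ω : Type*} [RCLike 𝕜] [MeasurableSpace Ω] (Pr : Measure Ω) {n : ℕ}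
    (X : Ω → Matrix (Fin n) (Fin n) 𝕜) : Prop :=
  ∀ U ∈ Matrix.unitaryGroup (Fin n) 𝕜,
    Measure.map (fun ω => U * X ω * star U) Pr = Measure.map X Pr

/-- The empirical eigenvalue distribution `(1/n) ∑ δ_{λ_j(A)}` of a Hermitian `n × n` matrix. -/
noncomputable def empiricalSpectralMeasure {𝕜 : Type*} [RCLike 𝕜] {n : ℕ}
    {A : Matrix (Fin n) (Fin n) 𝕜} (hA : A.IsHermitian) : Measure ℝ :=
  (n : ℝ≥0∞)⁻¹ • ∑ j, Measure.dirac (hA.eigenvalues j)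

/-- Weak convergence of a sequence of measures on the line: convergence of the integrals of all
bounded continuous functions. -/
def WeaklyConverges (ν : ℕ → Measure ℝ) (μ : Measure ℝ) : Prop :=
  ∀ f : BoundedContinuousFunction ℝ ℝ,
    Tendsto (fun n => ∫ t, f t ∂(ν n)) atTop (𝓝 (∫ t, f t ∂μ))

/-- The set of real eigenvalues of a square matrix. It is the whole spectrum for Hermitian
matrices, and also for `X * (1 + P)` with `X` positive semidefinite and `P` Hermitian, since this
matrix has the same characteristic polynomial as `X^(1/2) * (1 + P) * X^(1/2)`. -/
def realEigenvalues {𝕜 : Type*} [RCLike 𝕜] {n : ℕ} (A : Matrix (Fin n) (Fin n) 𝕜) : Set ℝ :=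
  {t : ℝ | Module.End.HasEigenvalue (Matrix.toEuclideanLin A) (t : 𝕜)}

/-- The largest eigenvalue `λ_1(A)`. -/
noncomputable def maxEigenvalue {𝕜 : Type*} [RCLike 𝕜] {n : ℕ}
    (A : Matrix (Fin n) (Fin n) 𝕜) : ℝ :=
  sSup (realEigenvalues A)

/-- The smallest eigenvalue `λ_n(A)`. -/
noncomputable def minEigenvalue {𝕜 : Type*} [RCLike 𝕜] {n : ℕ}
    (A : Matrix (Fin n) (Fin n) 𝕜) : ℝ :=
  sInf (realEigenvalues A)

/-- `v` is a unit-norm eigenvector of `A` with (real) eigenvalue `t`. -/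
def IsUnitEigenvector {𝕜 : Type*} [RCLike 𝕜] {n : ℕ} (A : Matrix (Fin n) (Fin n) 𝕜) (t : ℝ)
    (v : EuclideanSpace 𝕜 (Fin n)) : Prop :=
  ‖v‖ = 1 ∧ Module.End.HasEigenvector (Matrix.toEuclideanLin A) (t : 𝕜) v

/-- `ker (θ I - P)` as a subspace of the Euclidean space. -/
noncomputable def kerShift {𝕜 : Type*} [RCLike 𝕜] {n : ℕ} (θ : ℝ)
    (P : Matrix (Fin n) (Fin n) 𝕜) : Submodule 𝕜 (EuclideanSpace 𝕜 (Fin n)) :=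
  LinearMap.ker (Matrix.toEuclideanLin ((θ : 𝕜) • (1 : Matrix (Fin n) (Fin n) 𝕜) - P))

/-- The norm `⟨x, F⟩` of the orthogonal projection of `x` onto the subspace `F`. -/
noncomputable def projNorm {𝕜 : Type*} [RCLike 𝕜] {n : ℕ} (x : EuclideanSpace 𝕜 (Fin n))
    (F : Submodule 𝕜 (EuclideanSpace 𝕜 (Fin n))) : ℝ :=
  ‖F.starProjection x‖

/-- The T-transform `T_μ(z) = ∫ t / (z - t) dμ(t)` at real `z`; it is only used for `z` outside
the convex hull of the support of `μ`. -/
noncomputable def tTransform (μ : Measure ℝ) (z : ℝ) : ℝ := ∫ t, t / (z - t) ∂μ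

/-! Write `P = θ v v*` with `v` a unit vector. Let `λ_i` be the eigenvalues of `X`, let `v_i`, `u_i`
be the coordinates of `v` and of the eigenvector `u` in the eigenbasis of `X`, let `z` be the
eigenvalue of `u`, and put `c = ⟨v, u⟩`. The eigenvector equation is `(z - λ_i) u_i = θ λ_i c v_i`,
and `|c|` is the projection norm in question. Off the spectrum, pairing with `v` gives the secular
equation `1 = θ ∑ |v_i|² λ_i / (z - λ_i)` if `c ≠ 0`, while taking norms bounds `θ² |c|² ∑ |v_i|²
(λ_i / (z - λ_i))²` by `1`. So `c` is small once this last sum is large.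

Both sums are integrals against the weighted spectral measure `∑ |v_i|² δ_{λ_i}`. By unitary
invariance `v` may be taken Haar distributed relative to `X`. A fourth moment bound of order `n⁻²`
(`integral_quadForm_pow_four_le`) is summable, so almost surely all moments of the weighted measure
approach those of the empirical one (`ae_tendsto_traceDeviation`), and both measures converge to
`μ_X` (`tendsto_weighted_spectral`).

What remains is deterministic. For `θ > 0`, subcriticality gives `θ T(z) < 1` for every `z > b`, so
the secular equation keeps the top eigenvalue from leaving `b` to the right; comparison with `X`
(`maxEigenvalue_le_perturbed`) keeps it from falling below. Since `T'(b⁺) = -∞`, the integral of `(t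
/ (z - t))²` is unbounded for `z > b` (`exists_lt_integral_sq_div_sub`), which forces `c → 0`
(`tendsto_overlap_of_edge`). For `θ < 0` and `a > 0`, the reflection `t ↦ -t` reduces to the same
argument. If `a = 0`, the factor `t²` kills the divergence at the edge; instead, a fixed proportion
of `c` must come from eigenvalues near `0`, where the weighted measure has little mass because `μ_X`
has no atom there (`tendsto_overlap_of_edge_zero`). -/

/-! ### Moments of Rademacher sums -/

/-- The real sign attached to a Boolean. -/
def boolSign (b : Bool) : ℝ := if b then 1 else -1

lemma boolSign_sq (b : Bool) : boolSign b ^ 2 = 1 := by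
  cases b <;> norm_num [boolSign]

lemma sum_exp_rademacher {ι : Type*} [Fintype ι] [DecidableEq ι] (x : ι → ℝ) :
    ∑ ε : ι → Bool, Real.exp (∑ i, boolSign (ε i) * x i) =
      2 ^ Fintype.card ι * ∏ i, Real.cosh (x i) := by
  have h := Finset.prod_univ_sum (fun _ : ι => (Finset.univ : Finset Bool))
    (fun i b => Real.exp (boolSign b * x i))
  rw [Fintype.piFinset_univ] at h
  simp_rw [Real.exp_sum]
  rw [← h]
  simp only [Fintype.sum_bool]
  rw [← Finset.card_univ, ← Finset.prod_const, ← Finset.prod_mul_distrib]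
  refine Finset.prod_congr rfl fun i _ => ?_
  rw [Real.cosh_eq]
  simp [boolSign]
  ring

lemma pow_even_le_factorial_mul_exp (t : ℝ) (k : ℕ) :
    t ^ (2 * k) ≤ (2 * k).factorial * (Real.exp t + Real.exp (-t)) := by
  have h1 : |t| ^ (2 * k) / (2 * k).factorial ≤ Real.exp |t| :=
    Real.pow_div_factorial_le_exp _ (abs_nonneg t) _
  have h2 : Real.exp |t| ≤ Real.exp t + Real.exp (-t) := by
    rcases abs_cases t with ⟨h, _⟩ | ⟨h, _⟩ <;> rw [h] <;>
      linarith [Real.exp_pos t, Real.exp_pos (-t)]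
  have h3 : |t| ^ (2 * k) = t ^ (2 * k) := by rw [pow_mul, sq_abs, ← pow_mul]
  rw [h3, div_le_iff₀ (by positivity)] at h1
  nlinarith [h1, h2, (Nat.cast_pos (α := ℝ)).2 (Nat.factorial_pos (2 * k))]

/-- The constant in the Khintchine inequality for the moment of order `2 * k`. -/
noncomputable def khintchineConst (k : ℕ) : ℝ := (2 * k).factorial * (2 * Real.exp (1 / 2))

lemma khintchineConst_nonneg (k : ℕ) : 0 ≤ khintchineConst k := by
  unfold khintchineConst; positivity

/-- A Rademacher sum is subgaussian because `cosh x ≤ exp (x² / 2)`. Even powers are dominated by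
`(2k)! (e^t + e^{-t})`, so its exponential moment controls all even moments; the constant is not
sharp. -/
lemma khintchine_of_sum_sq_eq_one {ι : Type*} [Fintype ι] [DecidableEq ι] (x : ι → ℝ) (k : ℕ)
    (hx : ∑ i, x i ^ 2 = 1) :
    ∑ ε : ι → Bool, (∑ i, boolSign (ε i) * x i) ^ (2 * k) ≤
      2 ^ Fintype.card ι * khintchineConst k := by
  have hexp : ∀ y : ι → ℝ, ∑ i, y i ^ 2 = 1 →
      ∑ ε : ι → Bool, Real.exp (∑ i, boolSign (ε i) * y i) ≤
        2 ^ Fintype.card ι * Real.exp (1 / 2) := by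
    intro y hy
    rw [sum_exp_rademacher]
    gcongr
    calc ∏ i, Real.cosh (y i) ≤ ∏ i, Real.exp (y i ^ 2 / 2) :=
          Finset.prod_le_prod (fun i _ => (Real.cosh_pos _).le)
            fun i _ => Real.cosh_le_exp_half_sq _
      _ = Real.exp (1 / 2) := by rw [← Real.exp_sum, ← Finset.sum_div, hy]
  have h1 := hexp x hx
  have h2 := hexp (fun i => -x i) (by simpa using hx)
  calc _ ≤ ∑ ε : ι → Bool, (2 * k).factorial * (Real.exp (∑ i, boolSign (ε i) * x i) +
            Real.exp (-∑ i, boolSign (ε i) * x i)) :=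
        Finset.sum_le_sum fun ε _ => pow_even_le_factorial_mul_exp _ _
    _ = (2 * k).factorial * (∑ ε : ι → Bool, Real.exp (∑ i, boolSign (ε i) * x i) +
          ∑ ε : ι → Bool, Real.exp (∑ i, boolSign (ε i) * -x i)) := by
        rw [← Finset.sum_add_distrib, Finset.mul_sum]
        simp
    _ ≤ (2 * k).factorial * (2 ^ Fintype.card ι * Real.exp (1 / 2) +
          2 ^ Fintype.card ι * Real.exp (1 / 2)) := by gcongr
    _ = _ := by unfold khintchineConst; ring

/-- **Khintchine inequality** for even moments. -/
lemma khintchine {ι : Type*} [Fintype ι] [DecidableEq ι] (x : ι → ℝ) {k : ℕ} (hk : k ≠ 0) :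
    ∑ ε : ι → Bool, (∑ i, boolSign (ε i) * x i) ^ (2 * k) ≤
      2 ^ Fintype.card ι * khintchineConst k * (∑ i, x i ^ 2) ^ k := by
  set s := ∑ i, x i ^ 2 with hs
  have hs0 : 0 ≤ s := Finset.sum_nonneg fun i _ => sq_nonneg _
  rcases hs0.eq_or_lt with h0 | hpos
  · have hx : ∀ i, x i = 0 := fun i => by
      have := (Finset.sum_eq_zero_iff_of_nonneg fun i _ => sq_nonneg (x i)).1 h0.symm i
        (Finset.mem_univ i)
      exact pow_eq_zero_iff two_ne_zero |>.1 this
    simp [hx, hk, ← h0]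
  · have hsq : (√s) ^ 2 = s := Real.sq_sqrt hs0
    have h := khintchine_of_sum_sq_eq_one (fun i => x i / √s) k (by
      simp_rw [div_pow, hsq, ← Finset.sum_div]
      exact div_self hpos.ne')
    have e : ∀ ε : ι → Bool, (∑ i, boolSign (ε i) * (x i / √s)) ^ (2 * k) =
        (∑ i, boolSign (ε i) * x i) ^ (2 * k) / s ^ k := fun ε => by
      simp_rw [← mul_div_assoc, ← Finset.sum_div]
      rw [div_pow, pow_mul (√s), hsq]
    simp_rw [e, ← Finset.sum_div] at h
    rwa [div_le_iff₀ (by positivity)] at h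

/-! ### Haar measure on the unitary group -/

instance matrix_borelSpace {𝕜 : Type*} [RCLike 𝕜] (n : ℕ) :
    BorelSpace (Matrix (Fin n) (Fin n) 𝕜) :=
  inferInstanceAs (BorelSpace (Fin n → Fin n → 𝕜))

instance matrix_secondCountableTopology {𝕜 : Type*} [RCLike 𝕜] (n : ℕ) :
    SecondCountableTopology (Matrix (Fin n) (Fin n) 𝕜) :=
  inferInstanceAs (SecondCountableTopology (Fin n → Fin n → 𝕜))

instance unitaryGroup_borelSpace {𝕜 : Type*} [RCLike 𝕜] (n : ℕ) :
    BorelSpace (Matrix.unitaryGroup (Fin n) 𝕜) :=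
  Subtype.borelSpace _

instance unitaryGroup_secondCountableTopology {𝕜 : Type*} [RCLike 𝕜] (n : ℕ) :
    SecondCountableTopology (Matrix.unitaryGroup (Fin n) 𝕜) :=
  TopologicalSpace.Subtype.secondCountableTopology _

instance unitaryGroup_compactSpace {𝕜 : Type*} [RCLike 𝕜] (n : ℕ) :
    CompactSpace (Matrix.unitaryGroup (Fin n) 𝕜) := by
  suffices h : IsCompact (Matrix.unitaryGroup (Fin n) 𝕜 : Set (Matrix (Fin n) (Fin n) 𝕜)) from
    isCompact_iff_compactSpace.1 h
  have hbox : IsCompact (Set.pi Set.univ fun _ : Fin n => Set.pi Set.univ fun _ : Fin n =>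
      Metric.closedBall (0 : 𝕜) 1) :=
    isCompact_univ_pi fun _ => isCompact_univ_pi fun _ => isCompact_closedBall _ _
  have hbox' : IsCompact {A : Matrix (Fin n) (Fin n) 𝕜 | ∀ i ∈ Set.univ, ∀ j ∈ Set.univ,
      A i j ∈ Metric.closedBall (0 : 𝕜) 1} := hbox
  refine hbox'.of_isClosed_subset ?_ fun U hU i _ j _ => ?_
  · have : ((Matrix.unitaryGroup (Fin n) 𝕜 : Set (Matrix (Fin n) (Fin n) 𝕜))) =
        {A | star A * A = 1} := by
      ext A
      exact Matrix.mem_unitaryGroup_iff'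
    rw [this]
    exact isClosed_eq (by fun_prop) continuous_const
  · simpa using entry_norm_bound_of_unitary hU i j

lemma exists_haar_probability (𝕜 : Type*) [RCLike 𝕜] (n : ℕ) :
    ∃ ρ : Measure (Matrix.unitaryGroup (Fin n) 𝕜), IsProbabilityMeasure ρ ∧
      ρ.IsMulLeftInvariant := by
  refine ⟨Measure.haarMeasure ⊤, ⟨?_⟩, inferInstance⟩
  simpa using Measure.haarMeasure_self (K₀ := (⊤ : TopologicalSpace.PositiveCompacts
    (Matrix.unitaryGroup (Fin n) 𝕜)))

section Haar

variable {𝕜 : Type*} [RCLike 𝕜] {n : ℕ}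

@[fun_prop]
lemma continuous_unitary_mulVec_apply (v : Fin n → 𝕜) (i : Fin n) :
    Continuous fun U : Matrix.unitaryGroup (Fin n) 𝕜 => U.1.mulVec v i :=
  (continuous_apply i).comp (continuous_subtype_val.matrix_mulVec continuous_const)

variable (ρ : Measure (Matrix.unitaryGroup (Fin n) 𝕜))

lemma integrable_unitary [IsProbabilityMeasure ρ] {f : Matrix.unitaryGroup (Fin n) 𝕜 → ℝ} (hf : Continuous f) :
    Integrable f ρ := by
  obtain ⟨C, hC⟩ := isCompact_univ.exists_bound_of_continuousOn (hf.continuousOn (s := Set.univ))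
  exact Integrable.of_bound hf.aestronglyMeasurable C
    (Eventually.of_forall fun x => hC x (Set.mem_univ x))

lemma integral_unitary_mulVec [ρ.IsMulLeftInvariant] (F : (Fin n → 𝕜) → ℝ) (v : Fin n → 𝕜)
    {V : Matrix (Fin n) (Fin n) 𝕜} (hV : V ∈ Matrix.unitaryGroup (Fin n) 𝕜) :
    ∫ U : Matrix.unitaryGroup (Fin n) 𝕜, F (V.mulVec (U.1.mulVec v)) ∂ρ =
      ∫ U : Matrix.unitaryGroup (Fin n) 𝕜, F (U.1.mulVec v) ∂ρ := by
  have := integral_mul_left_eq_self (μ := ρ)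
    (fun U : Matrix.unitaryGroup (Fin n) 𝕜 => F (U.1.mulVec v)) ⟨V, hV⟩
  simpa [Matrix.mulVec_mulVec] using this

lemma sum_norm_sq_unitary_mulVec {U : Matrix (Fin n) (Fin n) 𝕜}
    (hU : U ∈ Matrix.unitaryGroup (Fin n) 𝕜) (v : Fin n → 𝕜) :
    ∑ i, ‖U.mulVec v i‖ ^ 2 = ∑ i, ‖v i‖ ^ 2 := by
  have key : ∀ w : Fin n → 𝕜, ((∑ i, ‖w i‖ ^ 2 : ℝ) : 𝕜) = star w ⬝ᵥ w := fun w => by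
    simp [dotProduct, RCLike.conj_mul]
  have : ((∑ i, ‖U.mulVec v i‖ ^ 2 : ℝ) : 𝕜) = ((∑ i, ‖v i‖ ^ 2 : ℝ) : 𝕜) := by
    rw [key, key, Matrix.star_mulVec, Matrix.dotProduct_mulVec, Matrix.vecMul_vecMul,
      ← Matrix.star_eq_conjTranspose, Matrix.mem_unitaryGroup_iff'.1 hU, Matrix.vecMul_one]
  exact_mod_cast this

/-- Realises any linear functional with unit coefficients as a coordinate after a rotation. By Haar
invariance all such functionals of `U v` then have the same law. -/
lemma exists_unitary_row (i : Fin n) (a : Fin n → 𝕜) (ha : ∑ j, ‖a j‖ ^ 2 = 1) :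
    ∃ V ∈ Matrix.unitaryGroup (Fin n) 𝕜, ∀ w : Fin n → 𝕜, V.mulVec w i = ∑ j, a j * w j := by
  let α : EuclideanSpace 𝕜 (Fin n) := WithLp.toLp 2 (star a)
  have hα : ‖α‖ = 1 := by
    rw [EuclideanSpace.norm_eq]
    simp [α, ha]
  obtain ⟨b, hb⟩ := Orthonormal.exists_orthonormalBasis_extension_of_card_eq (𝕜 := 𝕜)
    (E := EuclideanSpace 𝕜 (Fin n)) (ι := Fin n) (by simp) (v := fun _ => α) (s := {i})
    ⟨fun _ => hα, fun x y hxy => absurd (Subsingleton.elim x y) hxy⟩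
  refine ⟨Matrix.of fun k j => star (b k j), ?_, fun w => ?_⟩
  · rw [Matrix.mem_unitaryGroup_iff]
    ext k l
    have := b.inner_eq_ite k l
    simp only [Matrix.mul_apply, Matrix.star_apply, Matrix.of_apply, star_star, Matrix.one_apply]
    rw [← this]
    simp [PiLp.inner_apply, mul_comm]
  · have hbi := hb i rfl
    simp only [Matrix.mulVec, dotProduct, Matrix.of_apply, hbi]
    simp [α]

/-- Real and imaginary parts are treated separately by the real Khintchine inequality. The factor 16
is 8, from `(x + y)⁴ ≤ 8 (x⁴ + y⁴)`, times 2 for the two parts. -/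
lemma rademacher_pow_eight (w : Fin n → 𝕜) (hw : ∑ i, ‖w i‖ ^ 2 = 1) :
    ∑ ε : Fin n → Bool, ‖∑ i, ((boolSign (ε i) : ℝ) : 𝕜) * w i‖ ^ 8 ≤
      2 ^ n * (16 * khintchineConst 4) := by
  have hre := khintchine (fun i => RCLike.re (w i)) (k := 4) (by norm_num)
  have him := khintchine (fun i => RCLike.im (w i)) (k := 4) (by norm_num)
  have hsum : ∑ i, RCLike.re (w i) ^ 2 + ∑ i, RCLike.im (w i) ^ 2 = 1 := by
    rw [← Finset.sum_add_distrib, ← hw]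
    exact Finset.sum_congr rfl fun i _ => (RCLike.norm_sq_eq_def.trans (by ring)).symm
  have h0re : 0 ≤ ∑ i, RCLike.re (w i) ^ 2 := Finset.sum_nonneg fun i _ => sq_nonneg _
  have h0im : 0 ≤ ∑ i, RCLike.im (w i) ^ 2 := Finset.sum_nonneg fun i _ => sq_nonneg _
  have hk := khintchineConst_nonneg 4
  have hle : ∀ ε : Fin n → Bool, ‖∑ i, ((boolSign (ε i) : ℝ) : 𝕜) * w i‖ ^ 8 ≤
      8 * ((∑ i, boolSign (ε i) * RCLike.re (w i)) ^ (2 * 4) +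
        (∑ i, boolSign (ε i) * RCLike.im (w i)) ^ (2 * 4)) := fun ε => by
    have e : ‖∑ i, ((boolSign (ε i) : ℝ) : 𝕜) * w i‖ ^ 2 =
        (∑ i, boolSign (ε i) * RCLike.re (w i)) ^ 2 +
        (∑ i, boolSign (ε i) * RCLike.im (w i)) ^ 2 := by
      rw [RCLike.norm_sq_eq_def, map_sum, map_sum]
      simp only [RCLike.re_ofReal_mul, RCLike.im_ofReal_mul]
      ring
    have e8 : ‖∑ i, ((boolSign (ε i) : ℝ) : 𝕜) * w i‖ ^ 8 =
        (‖∑ i, ((boolSign (ε i) : ℝ) : 𝕜) * w i‖ ^ 2) ^ 4 := by ring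
    rw [e8, e, pow_mul _ 2 4, pow_mul _ 2 4]
    have := add_pow_le (sq_nonneg (∑ i, boolSign (ε i) * RCLike.re (w i)))
      (sq_nonneg (∑ i, boolSign (ε i) * RCLike.im (w i))) 4
    norm_num at this ⊢
    linarith
  refine (Finset.sum_le_sum fun ε _ => hle ε).trans ?_
  rw [← Finset.mul_sum, Finset.sum_add_distrib]
  simp only [Fintype.card_fin] at hre him
  have p1 : (∑ i, RCLike.re (w i) ^ 2) ^ 4 ≤ 1 := pow_le_one₀ h0re (by linarith)
  have p2 : (∑ i, RCLike.im (w i) ^ 2) ^ 4 ≤ 1 := pow_le_one₀ h0im (by linarith)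
  have hc : (0:ℝ) ≤ 2 ^ n * khintchineConst 4 := by positivity
  nlinarith [mul_le_mul_of_nonneg_left p1 hc, mul_le_mul_of_nonneg_left p2 hc]

/-- The entries of a Haar distributed unit vector have eighth moment of order `n⁻⁴`. -/
lemma integral_entry_pow_eight_le [IsProbabilityMeasure ρ] [ρ.IsMulLeftInvariant] (v : Fin n → 𝕜)
    (hv : ∑ i, ‖v i‖ ^ 2 = 1) (i : Fin n) :
    ∫ U : Matrix.unitaryGroup (Fin n) 𝕜, ‖U.1.mulVec v i‖ ^ 8 ∂ρ ≤
      16 * khintchineConst 4 / n ^ 4 := by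
  have hn : (0 : ℝ) < n := by exact_mod_cast i.pos
  set m := ∫ U : Matrix.unitaryGroup (Fin n) 𝕜, ‖U.1.mulVec v i‖ ^ 8 ∂ρ with hm
  -- For every sign pattern `ε / √n` is a unit vector, so the signed sum of the entries of `U v` has
  -- the law of `√n` times one entry. Averaging over `ε` before integrating over `U` lets Khintchine
  -- act pointwise in `U`.
  have hflat : ∀ ε : Fin n → Bool, ∫ U : Matrix.unitaryGroup (Fin n) 𝕜,
      ‖∑ j, ((boolSign (ε j) : ℝ) : 𝕜) * U.1.mulVec v j‖ ^ 8 ∂ρ = n ^ 4 * m := fun ε => by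
    obtain ⟨V, hV, hVi⟩ := exists_unitary_row i
      (fun j => ((boolSign (ε j) / √n : ℝ) : 𝕜)) (by
        simp only [RCLike.norm_ofReal, sq_abs, div_pow, boolSign_sq, Real.sq_sqrt hn.le]
        simp [hn.ne'])
    rw [hm, ← integral_unitary_mulVec ρ (fun w => ‖w i‖ ^ 8) v hV, ← integral_const_mul]
    congr 1
    ext U
    have e : ∑ j, ((boolSign (ε j) / √n : ℝ) : 𝕜) * U.1.mulVec v j =
        (((√n)⁻¹ : ℝ) : 𝕜) * ∑ j, ((boolSign (ε j) : ℝ) : 𝕜) * U.1.mulVec v j := by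
      rw [Finset.mul_sum]
      refine Finset.sum_congr rfl fun j _ => ?_
      push_cast
      ring
    rw [hVi, e, norm_mul, RCLike.norm_ofReal, mul_pow, abs_of_pos (by positivity), inv_pow,
      show (√(n:ℝ)) ^ 8 = ((√n) ^ 2) ^ 4 by ring, Real.sq_sqrt hn.le]
    field_simp
  have hint : ∀ ε : Fin n → Bool, Integrable (fun U : Matrix.unitaryGroup (Fin n) 𝕜 =>
      ‖∑ j, ((boolSign (ε j) : ℝ) : 𝕜) * U.1.mulVec v j‖ ^ 8) ρ := fun ε => by
    exact integrable_unitary ρ (by fun_prop)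
  have hsum : ∑ ε : Fin n → Bool, ∫ U : Matrix.unitaryGroup (Fin n) 𝕜,
      ‖∑ j, ((boolSign (ε j) : ℝ) : 𝕜) * U.1.mulVec v j‖ ^ 8 ∂ρ ≤
      2 ^ n * (16 * khintchineConst 4) := by
    rw [← integral_finsetSum _ fun ε _ => hint ε]
    calc _ ≤ ∫ _U : Matrix.unitaryGroup (Fin n) 𝕜, 2 ^ n * (16 * khintchineConst 4) ∂ρ :=
          integral_mono (integrable_finsetSum _ fun ε _ => hint ε) (integrable_const _)
            fun U => rademacher_pow_eight _ (by
              rw [sum_norm_sq_unitary_mulVec U.2, hv])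
      _ = _ := by simp
  simp_rw [hflat] at hsum
  rw [Finset.sum_const, Finset.card_univ, Fintype.card_fun, Fintype.card_fin, Fintype.card_bool,
    nsmul_eq_mul] at hsum
  push_cast at hsum
  rw [le_div_iff₀ (by positivity)]
  have := le_of_mul_le_mul_left hsum (by positivity)
  linarith

end Haar

/-! ### Concentration of quadratic forms in a Haar distributed unit vector -/

section Swap

variable {n : ℕ} (σ : Fin n → Fin n)

/-- Apply the involution `σ` on those of its orbits whose minimum carries the Boolean `false`. -/
def partialSwap (ε : Fin n → Bool) (i : Fin n) : Fin n := if ε (min i (σ i)) then i else σ i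

variable {σ}

/-- The Boolean sits at the minimum of the orbit, so `i` and `σ i` always take the same decision. -/
lemma partialSwap_involutive (hσ : Function.Involutive σ) (ε : Fin n → Bool) :
    Function.Involutive (partialSwap σ ε) := by
  intro i
  unfold partialSwap
  by_cases h : ε (min i (σ i))
  · simp [h]
  · have h' : ¬ ε (min (σ i) (σ (σ i))) := by rwa [hσ i, min_comm]
    rw [if_neg h, if_neg h', hσ i]

/-- Swapping an orbit changes the sign of `q i - q (σ i)`. Random swaps thus produce Rademacher
signs, one per orbit. -/
lemma partialSwap_sub (hσ : Function.Involutive σ) (ε : Fin n → Bool) (q : Fin n → ℝ)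
    (i : Fin n) : q (partialSwap σ ε i) - q (σ (partialSwap σ ε i)) =
      boolSign (ε (min i (σ i))) * (q i - q (σ i)) := by
  unfold partialSwap boolSign
  by_cases h : ε (min i (σ i)) <;> simp [h, hσ i]

lemma sum_swap_pow_four_le (hσ : Function.Involutive σ) (y q : Fin n → ℝ) (hq : ∀ i, 0 ≤ q i) :
    ∑ ε : Fin n → Bool, (∑ i, y i * (q (partialSwap σ ε i) - q (σ (partialSwap σ ε i)))) ^ 4 ≤
      2 ^ n * (8 * khintchineConst 2) *
        ((∑ i, y i ^ 2) * ∑ i, y i ^ 2 * (q i ^ 4 + q (σ i) ^ 4)) := by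
  classical
  -- All terms of one orbit share a sign, so they are gathered at the minimum of the orbit; `x j =
  -- 0` when `j` is not such a minimum.
  let x : Fin n → ℝ := fun j => ∑ i with min i (σ i) = j, y i * (q i - q (σ i))
  have e : ∀ ε : Fin n → Bool,
      ∑ i, y i * (q (partialSwap σ ε i) - q (σ (partialSwap σ ε i))) =
        ∑ j, boolSign (ε j) * x j := fun ε => by
    rw [← Finset.sum_fiberwise (s := Finset.univ) (g := fun i => min i (σ i))]
    refine Finset.sum_congr rfl fun j _ => ?_
    rw [Finset.mul_sum]
    refine Finset.sum_congr rfl fun i hi => ?_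
    rw [partialSwap_sub hσ, (Finset.mem_filter.1 hi).2]
    ring
  simp_rw [e]
  -- The factor 2 is the maximal size of an orbit, through Cauchy–Schwarz.
  have hx : ∑ j, x j ^ 2 ≤ 2 * ∑ i, y i ^ 2 * (q i - q (σ i)) ^ 2 := by
    rw [← Finset.sum_fiberwise (s := Finset.univ) (g := fun i => min i (σ i))
      (f := fun i => y i ^ 2 * (q i - q (σ i)) ^ 2), Finset.mul_sum]
    refine Finset.sum_le_sum fun j _ => ?_
    have hcard : (Finset.univ.filter fun i => min i (σ i) = j).card ≤ 2 := by
      refine (Finset.card_le_card (t := {j, σ j}) fun i hi => ?_).trans Finset.card_le_two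
      have hi := (Finset.mem_filter.1 hi).2
      rcases min_choice i (σ i) with h | h
      · simp [← hi, h]
      · simp [← hi, h, hσ i]
    refine sq_sum_le_card_mul_sum_sq.trans ?_
    simp_rw [mul_pow]
    gcongr
    exact_mod_cast hcard
  have hx0 : 0 ≤ ∑ j, x j ^ 2 := Finset.sum_nonneg fun _ _ => sq_nonneg _
  have hk := khintchine x (k := 2) (by norm_num)
  have hC := khintchineConst_nonneg 2
  have hcs : (∑ i, y i ^ 2 * (q i - q (σ i)) ^ 2) ^ 2 ≤
      (∑ i, y i ^ 2) * ∑ i, y i ^ 2 * (2 * (q i ^ 4 + q (σ i) ^ 4)) := by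
    have h := Finset.sum_mul_sq_le_sq_mul_sq Finset.univ y
      (fun i => y i * (q i - q (σ i)) ^ 2)
    have e2 : ∀ i, y i * (y i * (q i - q (σ i)) ^ 2) = y i ^ 2 * (q i - q (σ i)) ^ 2 :=
      fun i => by ring
    simp_rw [e2] at h
    refine h.trans ?_
    gcongr with i
    · rw [mul_pow, ← pow_mul]
      gcongr
      have h1 := hq i
      have h2 := hq (σ i)
      have h3 : (q i - q (σ i)) ^ 2 ≤ q i ^ 2 + q (σ i) ^ 2 := by nlinarith [mul_nonneg h1 h2]
      have h4 := pow_le_pow_left₀ (sq_nonneg _) h3 2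
      rw [← pow_mul] at h4
      nlinarith [h4, sq_nonneg (q i ^ 2 - q (σ i) ^ 2)]
  calc _ ≤ 2 ^ n * khintchineConst 2 * (∑ j, x j ^ 2) ^ 2 := by simpa using hk
    _ ≤ 2 ^ n * khintchineConst 2 * (2 * ∑ i, y i ^ 2 * (q i - q (σ i)) ^ 2) ^ 2 := by gcongr
    _ = 2 ^ n * khintchineConst 2 * 4 * (∑ i, y i ^ 2 * (q i - q (σ i)) ^ 2) ^ 2 := by ring
    _ ≤ 2 ^ n * khintchineConst 2 * 4 *
        ((∑ i, y i ^ 2) * ∑ i, y i ^ 2 * (2 * (q i ^ 4 + q (σ i) ^ 4))) := by gcongr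
    _ = _ := by
      have : ∑ i, y i ^ 2 * (2 * (q i ^ 4 + q (σ i) ^ 4)) =
          2 * ∑ i, y i ^ 2 * (q i ^ 4 + q (σ i) ^ 4) := by
        rw [Finset.mul_sum]
        exact Finset.sum_congr rfl fun i _ => by ring
      rw [this]
      ring

end Swap

/-- The constant in the fourth moment bound for quadratic forms. -/
noncomputable def quadFormConst : ℝ := 256 * khintchineConst 2 * khintchineConst 4

lemma quadFormConst_nonneg : 0 ≤ quadFormConst := by
  have := khintchineConst_nonneg 2
  have := khintchineConst_nonneg 4
  unfold quadFormConst; positivity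

section Concentration

variable {𝕜 : Type*} [RCLike 𝕜] {n : ℕ} (ρ : Measure (Matrix.unitaryGroup (Fin n) 𝕜))

lemma exists_unitary_perm (π : Equiv.Perm (Fin n)) :
    ∃ V ∈ Matrix.unitaryGroup (Fin n) 𝕜, ∀ w : Fin n → 𝕜, V.mulVec w = w ∘ π := by
  refine ⟨π.permMatrix 𝕜, ?_, fun w => Matrix.permMatrix_mulVec π⟩
  rw [Matrix.mem_unitaryGroup_iff, Matrix.star_eq_conjTranspose, Matrix.conjTranspose_permMatrix,
    ← Matrix.permMatrix_mul]
  simp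

/-- Permutation matrices are unitary, so partial swaps of the entries leave the law of `U v`
unchanged. Averaging over them inserts random signs at no cost. Khintchine then gains cancellation,
and the eighth moment bound on the entries finishes. -/
lemma integral_swap_pow_four_le [IsProbabilityMeasure ρ] [ρ.IsMulLeftInvariant] (v : Fin n → 𝕜)
    (hv : ∑ i, ‖v i‖ ^ 2 = 1) {σ : Fin n → Fin n} (hσ : Function.Involutive σ) (y : Fin n → ℝ) :
    ∫ U : Matrix.unitaryGroup (Fin n) 𝕜,
      (∑ i, y i * (‖U.1.mulVec v i‖ ^ 2 - ‖U.1.mulVec v (σ i)‖ ^ 2)) ^ 4 ∂ρ ≤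
      quadFormConst * (∑ i, y i ^ 2) ^ 2 / n ^ 4 := by
  set J := ∫ U : Matrix.unitaryGroup (Fin n) 𝕜,
      (∑ i, y i * (‖U.1.mulVec v i‖ ^ 2 - ‖U.1.mulVec v (σ i)‖ ^ 2)) ^ 4 ∂ρ with hJ
  have hswap : ∀ ε : Fin n → Bool, ∫ U : Matrix.unitaryGroup (Fin n) 𝕜,
      (∑ i, y i * (‖U.1.mulVec v (partialSwap σ ε i)‖ ^ 2 -
        ‖U.1.mulVec v (σ (partialSwap σ ε i))‖ ^ 2)) ^ 4 ∂ρ = J := fun ε => by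
    have hcomm : ∀ i, σ (partialSwap σ ε i) = partialSwap σ ε (σ i) := fun i => by
      unfold partialSwap
      rw [hσ i, min_comm (σ i) i]
      split_ifs <;> simp [hσ i]
    obtain ⟨V, hV, hVw⟩ := exists_unitary_perm (𝕜 := 𝕜)
      (partialSwap_involutive hσ ε).toPerm
    rw [hJ, ← integral_unitary_mulVec ρ
      (fun w => (∑ i, y i * (‖w i‖ ^ 2 - ‖w (σ i)‖ ^ 2)) ^ 4) v hV]
    simp [hVw, hcomm]
  have hint : ∀ ε : Fin n → Bool, Integrable (fun U : Matrix.unitaryGroup (Fin n) 𝕜 =>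
      (∑ i, y i * (‖U.1.mulVec v (partialSwap σ ε i)‖ ^ 2 -
        ‖U.1.mulVec v (σ (partialSwap σ ε i))‖ ^ 2)) ^ 4) ρ := fun ε =>
    integrable_unitary ρ (by fun_prop)
  have hint8 : ∀ i, Integrable (fun U : Matrix.unitaryGroup (Fin n) 𝕜 =>
      (‖U.1.mulVec v i‖ ^ 2) ^ 4) ρ := fun i => integrable_unitary ρ (by fun_prop)
  set m := 16 * khintchineConst 4 / (n : ℝ) ^ 4 with hm
  have h8 : ∀ i, ∫ U : Matrix.unitaryGroup (Fin n) 𝕜, (‖U.1.mulVec v i‖ ^ 2) ^ 4 ∂ρ ≤ m :=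
    fun i => by simpa only [← pow_mul] using integral_entry_pow_eight_le ρ v hv i
  have hC := khintchineConst_nonneg 2
  have hmain : 2 ^ n * J ≤ 2 ^ n * (8 * khintchineConst 2) *
      ((∑ i, y i ^ 2) * ∑ i, y i ^ 2 * (m + m)) := by
    calc 2 ^ n * J = ∑ ε : Fin n → Bool, ∫ U : Matrix.unitaryGroup (Fin n) 𝕜,
          (∑ i, y i * (‖U.1.mulVec v (partialSwap σ ε i)‖ ^ 2 -
            ‖U.1.mulVec v (σ (partialSwap σ ε i))‖ ^ 2)) ^ 4 ∂ρ := by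
          simp_rw [hswap]
          simp
      _ = ∫ U : Matrix.unitaryGroup (Fin n) 𝕜, ∑ ε : Fin n → Bool,
          (∑ i, y i * (‖U.1.mulVec v (partialSwap σ ε i)‖ ^ 2 -
            ‖U.1.mulVec v (σ (partialSwap σ ε i))‖ ^ 2)) ^ 4 ∂ρ :=
          (integral_finsetSum _ fun ε _ => hint ε).symm
      _ ≤ ∫ U : Matrix.unitaryGroup (Fin n) 𝕜, 2 ^ n * (8 * khintchineConst 2) *
          ((∑ i, y i ^ 2) * ∑ i, y i ^ 2 *
            ((‖U.1.mulVec v i‖ ^ 2) ^ 4 + (‖U.1.mulVec v (σ i)‖ ^ 2) ^ 4)) ∂ρ :=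
          integral_mono (integrable_finsetSum _ fun ε _ => hint ε)
            (integrable_unitary ρ (by fun_prop))
            fun U => sum_swap_pow_four_le hσ y (fun i => ‖U.1.mulVec v i‖ ^ 2)
              fun i => sq_nonneg _
      _ = 2 ^ n * (8 * khintchineConst 2) * ((∑ i, y i ^ 2) * ∑ i, y i ^ 2 *
            (∫ U : Matrix.unitaryGroup (Fin n) 𝕜, (‖U.1.mulVec v i‖ ^ 2) ^ 4 ∂ρ +
            ∫ U : Matrix.unitaryGroup (Fin n) 𝕜, (‖U.1.mulVec v (σ i)‖ ^ 2) ^ 4 ∂ρ)) := by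
          rw [integral_const_mul, integral_const_mul, integral_finsetSum]
          · congr 2
            refine Finset.sum_congr rfl fun i _ => ?_
            rw [integral_const_mul, integral_add (hint8 i) (hint8 (σ i))]
          · exact fun i _ => ((hint8 i).add (hint8 (σ i))).const_mul _
      _ ≤ _ := by
          gcongr
          · exact h8 _
          · exact h8 _
  rw [mul_assoc] at hmain
  refine (le_of_mul_le_mul_left hmain (by positivity)).trans_eq ?_
  -- The constant 256 is 8 from the swap estimate, 2 from `m + m` and 16 from the eighth moment.
  rw [← Finset.sum_mul, hm]
  unfold quadFormConst
  ring

/-- The reflections `i ↦ k - i` modulo `n` are involutions, and as `k` varies each `i` is paired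
with every index exactly once. The deviation from the mean is therefore an average of sums to which
the swap estimate applies. -/
lemma sum_weight_sub_average [NeZero n] (y q : Fin n → ℝ) :
    ∑ i, y i * q i - (∑ i, y i) / n * ∑ i, q i =
      (∑ k : Fin n, ∑ i, y i * (q i - q (k - i))) / n := by
  have hn : (n : ℝ) ≠ 0 := by exact_mod_cast NeZero.ne n
  have hs : ∀ i, ∑ k : Fin n, q (k - i) = ∑ k, q k := fun i =>
    (Equiv.subRight i).sum_comp q
  rw [Finset.sum_comm]
  simp_rw [← Finset.mul_sum, Finset.sum_sub_distrib, hs]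
  simp only [Finset.sum_const, Finset.card_univ, Fintype.card_fin, nsmul_eq_mul, mul_sub,
    Finset.sum_sub_distrib, ← Finset.sum_mul]
  rw [sub_div]
  congr 1
  · rw [eq_div_iff hn, Finset.sum_mul]
    exact Finset.sum_congr rfl fun i _ => by ring
  · ring

lemma average_pow_four_le [NeZero n] (D : Fin n → ℝ) :
    ((∑ k, D k) / n) ^ 4 ≤ (∑ k, D k ^ 4) / n := by
  have h (f : Fin n → ℝ) := sum_div_card_sq_le_sum_sq_div_card (s := Finset.univ) (f := f)
  simp only [Finset.card_univ, Fintype.card_fin] at h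
  calc ((∑ k, D k) / n) ^ 4 = (((∑ k, D k) / n) ^ 2) ^ 2 := by ring
    _ ≤ ((∑ k, D k ^ 2) / n) ^ 2 := by gcongr; exact h D
    _ ≤ (∑ k, (D k ^ 2) ^ 2) / n := h _
    _ = _ := by simp_rw [← pow_mul]

lemma integral_weighted_pow_four_le [IsProbabilityMeasure ρ] [ρ.IsMulLeftInvariant] [NeZero n]
    (v : Fin n → 𝕜) (hv : ∑ i, ‖v i‖ ^ 2 = 1) (y : Fin n → ℝ) :
    ∫ U : Matrix.unitaryGroup (Fin n) 𝕜,
      (∑ i, y i * ‖U.1.mulVec v i‖ ^ 2 - (∑ i, y i) / n) ^ 4 ∂ρ ≤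
      quadFormConst * (∑ i, y i ^ 2) ^ 2 / n ^ 4 := by
  have hn : (0 : ℝ) < n := by exact_mod_cast NeZero.pos n
  have hint : ∀ k : Fin n, Integrable (fun U : Matrix.unitaryGroup (Fin n) 𝕜 =>
      (∑ i, y i * (‖U.1.mulVec v i‖ ^ 2 - ‖U.1.mulVec v (k - i)‖ ^ 2)) ^ 4) ρ := fun k =>
    integrable_unitary ρ (by fun_prop)
  calc _ ≤ ∫ U : Matrix.unitaryGroup (Fin n) 𝕜,
      (∑ k : Fin n, (∑ i, y i * (‖U.1.mulVec v i‖ ^ 2 - ‖U.1.mulVec v (k - i)‖ ^ 2)) ^ 4) / n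
        ∂ρ := by
        refine integral_mono (integrable_unitary ρ (by fun_prop))
          ((integrable_finsetSum _ fun k _ => hint k).div_const _) fun U => ?_
        have h := sum_weight_sub_average y fun i => ‖U.1.mulVec v i‖ ^ 2
        rw [sum_norm_sq_unitary_mulVec U.2, hv, mul_one] at h
        simp only [h]
        exact average_pow_four_le _
    _ ≤ (∑ _k : Fin n, quadFormConst * (∑ i, y i ^ 2) ^ 2 / n ^ 4) / n := by
        rw [integral_div, integral_finsetSum _ fun k _ => hint k]
        gcongr with k
        exact integral_swap_pow_four_le ρ v hv (fun i => by simp) y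
    _ = _ := by
        simp only [Finset.sum_const, Finset.card_univ, Fintype.card_fin, nsmul_eq_mul]
        field_simp

end Concentration

/-! ### Spectral decomposition of quadratic forms -/

section Spectral

variable {𝕜 : Type*} [RCLike 𝕜] {n : ℕ} {Y : Matrix (Fin n) (Fin n) 𝕜} (hY : Y.IsHermitian)

/-- The coordinates of a vector in the eigenbasis of a Hermitian matrix. -/
noncomputable def eigenCoord (w : Fin n → 𝕜) : Fin n → 𝕜 :=
  (star (hY.eigenvectorUnitary : Matrix (Fin n) (Fin n) 𝕜)).mulVec w

lemma star_eigenvectorUnitary_mem :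
    star (hY.eigenvectorUnitary : Matrix (Fin n) (Fin n) 𝕜) ∈ Matrix.unitaryGroup (Fin n) 𝕜 :=
  Unitary.star_mem hY.eigenvectorUnitary.2

lemma sum_norm_sq_eigenCoord (w : Fin n → 𝕜) :
    ∑ i, ‖eigenCoord hY w i‖ ^ 2 = ∑ i, ‖w i‖ ^ 2 :=
  sum_norm_sq_unitary_mulVec (star_eigenvectorUnitary_mem hY) w

lemma eigenCoord_mulVec (w : Fin n → 𝕜) (i : Fin n) :
    eigenCoord hY (Y.mulVec w) i = (hY.eigenvalues i : 𝕜) * eigenCoord hY w i := by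
  have h : star (hY.eigenvectorUnitary : Matrix (Fin n) (Fin n) 𝕜) * Y =
      Matrix.diagonal (RCLike.ofReal ∘ hY.eigenvalues) *
        star (hY.eigenvectorUnitary : Matrix (Fin n) (Fin n) 𝕜) := by
    have hs := congrArg (star (hY.eigenvectorUnitary : Matrix (Fin n) (Fin n) 𝕜) * ·)
      hY.spectral_theorem
    simp only [Unitary.conjStarAlgAut_apply, ← mul_assoc] at hs
    rwa [Unitary.star_mul_self_of_mem hY.eigenvectorUnitary.2, one_mul] at hs
  unfold eigenCoord
  rw [Matrix.mulVec_mulVec, h, ← Matrix.mulVec_mulVec, Matrix.mulVec_diagonal]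
  rfl

lemma eigenCoord_pow_mulVec (w : Fin n → 𝕜) (k : ℕ) (i : Fin n) :
    eigenCoord hY ((Y ^ k).mulVec w) i = ((hY.eigenvalues i ^ k : ℝ) : 𝕜) * eigenCoord hY w i := by
  induction k with
  | zero => simp
  | succ k ih =>
    rw [pow_succ', ← Matrix.mulVec_mulVec, eigenCoord_mulVec, ih, pow_succ']
    push_cast
    ring

lemma star_dotProduct_eigenCoord (v w : Fin n → 𝕜) :
    star (eigenCoord hY v) ⬝ᵥ eigenCoord hY w = star v ⬝ᵥ w := by
  unfold eigenCoord
  rw [Matrix.star_mulVec, Matrix.dotProduct_mulVec, Matrix.vecMul_vecMul,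
    ← Matrix.star_eq_conjTranspose, star_star, Unitary.mul_star_self_of_mem hY.eigenvectorUnitary.2, Matrix.vecMul_one]

lemma star_dotProduct_pow_mulVec (w : Fin n → 𝕜) (k : ℕ) :
    star w ⬝ᵥ (Y ^ k).mulVec w =
      ((∑ i, hY.eigenvalues i ^ k * ‖eigenCoord hY w i‖ ^ 2 : ℝ) : 𝕜) := by
  rw [← star_dotProduct_eigenCoord hY]
  simp only [dotProduct, eigenCoord_pow_mulVec, Pi.star_apply, RCLike.star_def]
  push_cast
  refine Finset.sum_congr rfl fun i _ => ?_
  rw [mul_left_comm, RCLike.conj_mul]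

lemma trace_pow_eq_sum (k : ℕ) :
    (Y ^ k).trace = ((∑ i, hY.eigenvalues i ^ k : ℝ) : 𝕜) := by
  conv_lhs => rw [hY.spectral_theorem]
  rw [← map_pow, Unitary.conjStarAlgAut_apply, Matrix.trace_mul_comm, ← mul_assoc,
    Unitary.coe_star_mul_self, one_mul, Matrix.diagonal_pow, Matrix.trace_diagonal]
  simp

end Spectral

/-- In the eigenbasis of `Y` the quadratic form is a weighted sum of squared entries with weights
`λ_i ^ k`; Haar invariance absorbs the change of basis. -/
lemma integral_quadForm_pow_four_le {𝕜 : Type*} [RCLike 𝕜] {n : ℕ}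
    {Y : Matrix (Fin n) (Fin n) 𝕜} (hY : Y.IsHermitian) (ρ : Measure (Matrix.unitaryGroup (Fin n) 𝕜))
    [IsProbabilityMeasure ρ] [ρ.IsMulLeftInvariant] [NeZero n] (v : Fin n → 𝕜)
    (hv : ∑ i, ‖v i‖ ^ 2 = 1) (k : ℕ) :
    ∫ U : Matrix.unitaryGroup (Fin n) 𝕜,
      (RCLike.re (star (U.1.mulVec v) ⬝ᵥ (Y ^ k).mulVec (U.1.mulVec v)) -
        RCLike.re (Y ^ k).trace / n) ^ 4 ∂ρ ≤
      quadFormConst * RCLike.re (Y ^ (2 * k)).trace ^ 2 / n ^ 4 := by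
  have h := integral_weighted_pow_four_le ρ v hv fun i => hY.eigenvalues i ^ k
  rw [← integral_unitary_mulVec ρ (fun w => (∑ i, hY.eigenvalues i ^ k * ‖w i‖ ^ 2 -
    (∑ i, hY.eigenvalues i ^ k) / n) ^ 4) v (star_eigenvectorUnitary_mem hY)] at h
  simp_rw [← pow_mul, mul_comm k 2] at h
  simp only [star_dotProduct_pow_mulVec hY, trace_pow_eq_sum hY, RCLike.ofReal_re]
  exact h

/-! ### Rank one Hermitian matrices -/

section RankOne

variable {𝕜 : Type*} [RCLike 𝕜] {n : ℕ}

lemma exists_eigenvector_of_mem_realEigenvalues {A : Matrix (Fin n) (Fin n) 𝕜} {t : ℝ}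
    (ht : t ∈ realEigenvalues A) :
    ∃ v : Fin n → 𝕜, ∑ i, ‖v i‖ ^ 2 = 1 ∧ A.mulVec v = (t : 𝕜) • v := by
  obtain ⟨x, hx⟩ := Module.End.HasEigenvalue.exists_hasEigenvector ht
  have hx0 : ‖x‖ ≠ 0 := norm_ne_zero_iff.2 hx.2
  have hAx : A.mulVec x.ofLp = (t : 𝕜) • x.ofLp := by
    have := congrArg WithLp.ofLp hx.apply_eq_smul
    simpa using this
  refine ⟨((‖x‖⁻¹ : ℝ) : 𝕜) • x.ofLp, ?_, ?_⟩
  · have := EuclideanSpace.norm_sq_eq x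
    simp only [Pi.smul_apply, smul_eq_mul, norm_mul, RCLike.norm_ofReal, mul_pow, sq_abs,
      ← Finset.mul_sum, ← this]
    field_simp
  · rw [Matrix.mulVec_smul, hAx, smul_comm]

lemma mem_realEigenvalues {A : Matrix (Fin n) (Fin n) 𝕜} {t : ℝ} {v : Fin n → 𝕜} (hv : v ≠ 0)
    (h : A.mulVec v = (t : 𝕜) • v) : t ∈ realEigenvalues A := by
  refine Module.End.hasEigenvalue_of_hasEigenvector (x := WithLp.toLp 2 v)
    ⟨Module.End.mem_eigenspace_iff.2 ?_, by simpa using hv⟩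
  ext i
  simpa [RCLike.real_smul_eq_coe_mul] using congrFun h i

lemma finite_realEigenvalues (A : Matrix (Fin n) (Fin n) 𝕜) : (realEigenvalues A).Finite :=
  (Module.End.finite_hasEigenvalue (Matrix.toEuclideanLin A)).preimage
    (RCLike.ofReal_injective (K := 𝕜)).injOn

lemma ne_zero_of_sum_norm_sq {v : Fin n → 𝕜} (hv : ∑ i, ‖v i‖ ^ 2 = 1) : v ≠ 0 := by
  rintro rfl
  simp at hv

lemma star_dotProduct_self (v : Fin n → 𝕜) : star v ⬝ᵥ v = ((∑ i, ‖v i‖ ^ 2 : ℝ) : 𝕜) := by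
  simp [dotProduct, RCLike.conj_mul]

/-- Rank one makes the range the line through a unit eigenvector `v`; Hermitian symmetry then
identifies the coefficient of `P x` along `v` as `θ ⟨v, x⟩`. -/
lemma exists_eq_smul_vecMulVec {P : Matrix (Fin n) (Fin n) 𝕜} (hP : P.IsHermitian)
    (hrank : P.rank = 1) {θ : ℝ} (hθ : θ ≠ 0) (heig : θ ∈ realEigenvalues P) :
    ∃ v : Fin n → 𝕜, ∑ i, ‖v i‖ ^ 2 = 1 ∧ P = (θ : 𝕜) • Matrix.vecMulVec v (star v) := by
  obtain ⟨v, hv, hPv⟩ := exists_eigenvector_of_mem_realEigenvalues heig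
  refine ⟨v, hv, ?_⟩
  have hθ' : (θ : 𝕜) ≠ 0 := by exact_mod_cast hθ
  have hvmem : v ∈ LinearMap.range P.mulVecLin :=
    ⟨(θ : 𝕜)⁻¹ • v, by
      rw [Matrix.mulVecLin_apply, Matrix.mulVec_smul, hPv, smul_smul, inv_mul_cancel₀ hθ', one_smul]⟩
  have hspan := (finrank_eq_one_iff_of_nonzero' (⟨v, hvmem⟩ : LinearMap.range P.mulVecLin)
    (by simpa using ne_zero_of_sum_norm_sq hv)).1 hrank
  have key : ∀ x : Fin n → 𝕜, P.mulVec x = ((θ : 𝕜) * (star v ⬝ᵥ x)) • v := by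
    intro x
    obtain ⟨c, hc⟩ := hspan ⟨P.mulVec x, ⟨x, rfl⟩⟩
    have hc : c • v = P.mulVec x := congrArg Subtype.val hc
    have h1 : star v ⬝ᵥ P.mulVec x = (θ : 𝕜) * (star v ⬝ᵥ x) := by
      rw [Matrix.dotProduct_mulVec]
      have : Matrix.vecMul (star v) P = (θ : 𝕜) • star v := by
        have := congrArg star hPv
        rw [Matrix.star_mulVec, hP.eq] at this
        simpa using this
      rw [this, smul_dotProduct, smul_eq_mul]
    rw [← hc, dotProduct_smul, star_dotProduct_self, hv] at h1
    rw [← hc, ← h1]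
    simp
  refine Matrix.ext_of_mulVec_single fun j => ?_
  rw [key, Matrix.smul_mulVec, Matrix.vecMulVec_mulVec]
  ext i
  simp
  ring

lemma trace_rankOne_mul (θ : ℝ) (v : Fin n → 𝕜) (A : Matrix (Fin n) (Fin n) 𝕜) :
    (((θ : 𝕜) • Matrix.vecMulVec v (star v)) * A).trace = θ * (star v ⬝ᵥ A.mulVec v) := by
  rw [smul_mul_assoc, Matrix.trace_smul, smul_eq_mul, Matrix.vecMulVec_mul,
    Matrix.trace_vecMulVec, dotProduct_comm, ← Matrix.dotProduct_mulVec]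

lemma conj_rankOne (θ : ℝ) (v : Fin n → 𝕜) (U : Matrix (Fin n) (Fin n) 𝕜) :
    U * ((θ : 𝕜) • Matrix.vecMulVec v (star v)) * star U =
      (θ : 𝕜) • Matrix.vecMulVec (U.mulVec v) (star (U.mulVec v)) := by
  rw [mul_smul_comm, smul_mul_assoc, Matrix.mul_vecMulVec, Matrix.vecMulVec_mul,
    Matrix.star_mulVec, Matrix.star_eq_conjTranspose]

end RankOne

/-! ### Almost sure concentration under unitary invariance -/

section Averaging

variable {𝕜 Ω : Type*} [RCLike 𝕜] [MeasurableSpace Ω] {Pr : Measure Ω} [IsProbabilityMeasure Pr]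
  {n : ℕ}

/-- Independence turns the joint law into a product. As `G` sees only the relative position of its
arguments, rotating `P` amounts to rotating `X` the other way, so invariance of either law suffices.
-/
lemma lintegral_eq_average_conj {X P : Ω → Matrix (Fin n) (Fin n) 𝕜} (hX : Measurable X)
    (hP : Measurable P) (hind : IndepFun X P Pr)
    (hinv : ConjInvariant Pr X ∨ ConjInvariant Pr P)
    (ρ : Measure (Matrix.unitaryGroup (Fin n) 𝕜)) [IsProbabilityMeasure ρ]
    {G : Matrix (Fin n) (Fin n) 𝕜 × Matrix (Fin n) (Fin n) 𝕜 → ℝ≥0∞} (hG : Measurable G)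
    (hGinv : ∀ U ∈ Matrix.unitaryGroup (Fin n) 𝕜, ∀ A B,
      G (U * A * star U, U * B * star U) = G (A, B)) :
    ∫⁻ ω, G (X ω, P ω) ∂Pr = ∫⁻ ω, ∫⁻ ω', ∫⁻ U : Matrix.unitaryGroup (Fin n) 𝕜,
      G (X ω, U.1 * P ω' * star U.1) ∂ρ ∂Pr ∂Pr := by
  have hpair : ∫⁻ ω, G (X ω, P ω) ∂Pr = ∫⁻ ω, ∫⁻ ω', G (X ω, P ω') ∂Pr ∂Pr := by
    have h := (indepFun_iff_map_prod_eq_prod_map_map hX.aemeasurable hP.aemeasurable).1 hind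
    rw [← lintegral_map hG (hX.prodMk hP), h, lintegral_prod _ hG.aemeasurable,
      lintegral_map (hG.lintegral_prod_right') hX]
    refine lintegral_congr fun ω => ?_
    exact lintegral_map (hG.comp measurable_prodMk_left) hP
  have hmeas : Measurable fun z : (Ω × Ω) × Matrix.unitaryGroup (Fin n) 𝕜 =>
      G (X z.1.1, z.2.1 * P z.1.2 * star z.2.1) := by
    have hc : Continuous fun z : Matrix.unitaryGroup (Fin n) 𝕜 × Matrix (Fin n) (Fin n) 𝕜 =>
        z.1.1 * z.2 * star z.1.1 := by fun_prop
    have h1 : Measurable fun z : (Ω × Ω) × Matrix.unitaryGroup (Fin n) 𝕜 => X z.1.1 :=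
      hX.comp (measurable_fst.comp measurable_fst)
    have h2 : Measurable fun z : (Ω × Ω) × Matrix.unitaryGroup (Fin n) 𝕜 => (z.2, P z.1.2) :=
      measurable_snd.prodMk (hP.comp (measurable_snd.comp measurable_fst))
    have h3 : Measurable fun z : (Ω × Ω) × Matrix.unitaryGroup (Fin n) 𝕜 =>
        z.2.1 * P z.1.2 * star z.2.1 := by
      have := hc.measurable.comp h2
      exact this
    exact hG.comp (h1.prodMk h3)
  have hconj : ∀ U : Matrix (Fin n) (Fin n) 𝕜, ∀ {A : Ω → Matrix (Fin n) (Fin n) 𝕜},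
      Measurable A → Measurable fun ω => U * A ω * star U := fun U A hA => by
    have hc : Continuous fun A : Matrix (Fin n) (Fin n) 𝕜 => U * A * star U := by fun_prop
    have := hc.measurable.comp hA
    exact this
  rw [hpair]
  rcases hinv with hinv | hinv
  · have hsw : ∀ ω', ∫⁻ ω, G (X ω, P ω') ∂Pr =
        ∫⁻ ω, ∫⁻ U : Matrix.unitaryGroup (Fin n) 𝕜, G (X ω, U.1 * P ω' * star U.1) ∂ρ ∂Pr := by
      intro ω'
      rw [lintegral_lintegral_swap (f := fun ω (U : Matrix.unitaryGroup (Fin n) 𝕜) =>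
        G (X ω, U.1 * P ω' * star U.1))
        (hmeas.comp ((measurable_fst.prodMk measurable_const).prodMk measurable_snd)).aemeasurable]
      have : ∀ U : Matrix.unitaryGroup (Fin n) 𝕜,
          ∫⁻ ω, G (X ω, U.1 * P ω' * star U.1) ∂Pr = ∫⁻ ω, G (X ω, P ω') ∂Pr := by
        intro U
        have hg : Measurable fun A : Matrix (Fin n) (Fin n) 𝕜 => G (A, U.1 * P ω' * star U.1) :=
          hG.comp measurable_prodMk_right
        rw [← lintegral_map hg hX, ← hinv U.1 U.2, lintegral_map hg (hconj U.1 hX)]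
        exact lintegral_congr fun ω => hGinv U.1 U.2 _ _
      simp [this]
    rw [lintegral_lintegral_swap (f := fun ω ω' => G (X ω, P ω'))
      (hG.comp ((hX.comp measurable_fst).prodMk (hP.comp measurable_snd))).aemeasurable]
    simp_rw [hsw]
    exact lintegral_lintegral_swap (hmeas.lintegral_prod_right'.comp
      measurable_swap).aemeasurable
  · refine lintegral_congr fun ω => ?_
    rw [lintegral_lintegral_swap (f := fun ω' (U : Matrix.unitaryGroup (Fin n) 𝕜) =>
        G (X ω, U.1 * P ω' * star U.1))
        (hmeas.comp ((measurable_const.prodMk measurable_fst).prodMk measurable_snd)).aemeasurable]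
    have : ∀ U : Matrix.unitaryGroup (Fin n) 𝕜,
        ∫⁻ ω', G (X ω, U.1 * P ω' * star U.1) ∂Pr = ∫⁻ ω', G (X ω, P ω') ∂Pr := by
      intro U
      have hg : Measurable fun B : Matrix (Fin n) (Fin n) 𝕜 => G (X ω, B) :=
        hG.comp measurable_prodMk_left
      rw [← lintegral_map hg hP, ← hinv U.1 U.2, lintegral_map hg (hconj U.1 hP)]
    simp [this]

end Averaging

/-! ### Trace deviations and their almost sure vanishing -/

section Concentration

variable {𝕜 : Type*} [RCLike 𝕜]

/-- The normalised fourth power of the deviation of `tr (P X ^ k) / θ` from `tr (X ^ k) / n`. -/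
noncomputable def traceDeviation {n : ℕ} (θ : ℝ) (k : ℕ) (A B : Matrix (Fin n) (Fin n) 𝕜) : ℝ :=
  (RCLike.re (B * A ^ k).trace / θ - RCLike.re (A ^ k).trace / n) ^ 4 /
    (1 + (RCLike.re (A ^ (2 * k)).trace / n) ^ 2)

lemma traceDeviation_nonneg {n : ℕ} (θ : ℝ) (k : ℕ) (A B : Matrix (Fin n) (Fin n) 𝕜) :
    0 ≤ traceDeviation θ k A B :=
  div_nonneg (by positivity) (by positivity)

lemma continuous_traceDeviation {n : ℕ} (θ : ℝ) (k : ℕ) :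
    Continuous fun z : Matrix (Fin n) (Fin n) 𝕜 × Matrix (Fin n) (Fin n) 𝕜 =>
      traceDeviation θ k z.1 z.2 := by
  unfold traceDeviation
  refine Continuous.div ?_ ?_ fun z => by positivity
  · have h1 : Continuous fun z : Matrix (Fin n) (Fin n) 𝕜 × Matrix (Fin n) (Fin n) 𝕜 =>
      (z.2 * z.1 ^ k).trace := (continuous_snd.mul (continuous_fst.pow k)).matrix_trace
    have h2 : Continuous fun z : Matrix (Fin n) (Fin n) 𝕜 × Matrix (Fin n) (Fin n) 𝕜 =>
      (z.1 ^ k).trace := (continuous_fst.pow k).matrix_trace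
    exact (((RCLike.continuous_re.comp h1).div_const _).sub
      ((RCLike.continuous_re.comp h2).div_const _)).pow 4
  · have h2 : Continuous fun z : Matrix (Fin n) (Fin n) 𝕜 × Matrix (Fin n) (Fin n) 𝕜 =>
      (z.1 ^ (2 * k)).trace := (continuous_fst.pow (2 * k)).matrix_trace
    exact continuous_const.add (((RCLike.continuous_re.comp h2).div_const _).pow 2)

lemma traceDeviation_conj {n : ℕ} (θ : ℝ) (k : ℕ) {U : Matrix (Fin n) (Fin n) 𝕜}
    (hU : U ∈ Matrix.unitaryGroup (Fin n) 𝕜) (A B : Matrix (Fin n) (Fin n) 𝕜) :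
    traceDeviation θ k (U * A * star U) (U * B * star U) = traceDeviation θ k A B := by
  have hU' := Matrix.mem_unitaryGroup_iff'.1 hU
  have hpow : ∀ k, (U * A * star U) ^ k = U * A ^ k * star U := fun k => by
    induction k with
    | zero => simp [Matrix.mem_unitaryGroup_iff.1 hU]
    | succ k ih =>
      rw [pow_succ, ih, pow_succ]
      simp only [mul_assoc]
      rw [← mul_assoc (star U) U, hU', one_mul]
  have htr : ∀ C : Matrix (Fin n) (Fin n) 𝕜, (U * C * star U).trace = C.trace := fun C => by
    rw [Matrix.trace_mul_comm, ← mul_assoc, hU', one_mul]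
  have hmul : U * B * star U * (U * A ^ k * star U) = U * (B * A ^ k) * star U := by
    simp only [mul_assoc]
    rw [← mul_assoc (star U) U, hU', one_mul]
  unfold traceDeviation
  rw [hpow, hpow, hmul, htr, htr, htr]

/-- The fourth moment bound involves `(tr A ^ (2k) / n)²`, whose expectation need not be finite. The
denominator of `traceDeviation` cancels it and leaves a bound that is uniform in `A`. -/
lemma integral_traceDeviation_le {n : ℕ} [NeZero n]
    (ρ : Measure (Matrix.unitaryGroup (Fin n) 𝕜)) [IsProbabilityMeasure ρ]
    [ρ.IsMulLeftInvariant] {θ : ℝ} (hθ : θ ≠ 0) (k : ℕ) {A B : Matrix (Fin n) (Fin n) 𝕜}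
    (hA : A.IsHermitian) (hB : B.IsHermitian) (hrank : B.rank = 1)
    (heig : θ ∈ realEigenvalues B) :
    ∫ U : Matrix.unitaryGroup (Fin n) 𝕜, traceDeviation θ k A (U.1 * B * star U.1) ∂ρ ≤
      quadFormConst / n ^ 2 := by
  obtain ⟨v, hv, rfl⟩ := exists_eq_smul_vecMulVec hB hrank hθ heig
  have hn : (0 : ℝ) < n := by exact_mod_cast NeZero.pos n
  have h := integral_quadForm_pow_four_le hA ρ v hv k
  have e : ∀ U : Matrix.unitaryGroup (Fin n) 𝕜, RCLike.re ((U.1 * ((θ : 𝕜) •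
      Matrix.vecMulVec v (star v)) * star U.1) * A ^ k).trace / θ =
      RCLike.re (star (U.1.mulVec v) ⬝ᵥ (A ^ k).mulVec (U.1.mulVec v)) := fun U => by
    rw [conj_rankOne, trace_rankOne_mul, RCLike.re_ofReal_mul]
    field_simp
  simp only [traceDeviation, e]
  rw [integral_div]
  set s := RCLike.re (A ^ (2 * k)).trace
  rw [div_le_iff₀ (by positivity)]
  refine h.trans ?_
  have hC := quadFormConst_nonneg
  have : quadFormConst * s ^ 2 / n ^ 4 = quadFormConst / n ^ 2 * (s / n) ^ 2 := by
    field_simp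
  rw [this]
  gcongr
  linarith

variable {Ω : Type*} [MeasurableSpace Ω] {Pr : Measure Ω} [IsProbabilityMeasure Pr]

lemma lintegral_traceDeviation_le {n : ℕ} [NeZero n] {X P : Ω → Matrix (Fin n) (Fin n) 𝕜}
    (hX : Measurable X) (hP : Measurable P) (hind : IndepFun X P Pr)
    (hinv : ConjInvariant Pr X ∨ ConjInvariant Pr P) {θ : ℝ} (hθ : θ ≠ 0) (k : ℕ)
    (hXh : ∀ ω, (X ω).IsHermitian) (hPh : ∀ ω, (P ω).IsHermitian) (hrank : ∀ ω, (P ω).rank = 1)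
    (heig : ∀ ω, θ ∈ realEigenvalues (P ω)) :
    ∫⁻ ω, ENNReal.ofReal (traceDeviation θ k (X ω) (P ω)) ∂Pr ≤
      ENNReal.ofReal (quadFormConst / n ^ 2) := by
  obtain ⟨ρ, _, _⟩ := exists_haar_probability 𝕜 n
  rw [lintegral_eq_average_conj hX hP hind hinv ρ
    (G := fun z => ENNReal.ofReal (traceDeviation θ k z.1 z.2))
    (continuous_traceDeviation θ k).measurable.ennreal_ofReal
    (fun U hU A B => by rw [traceDeviation_conj θ k hU])]
  have hle : ∀ ω ω', ∫⁻ U : Matrix.unitaryGroup (Fin n) 𝕜,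
      ENNReal.ofReal (traceDeviation θ k (X ω) (U.1 * P ω' * star U.1)) ∂ρ ≤
      ENNReal.ofReal (quadFormConst / n ^ 2) := fun ω ω' => by
    have hc : Continuous fun U : Matrix.unitaryGroup (Fin n) 𝕜 =>
        traceDeviation θ k (X ω) (U.1 * P ω' * star U.1) := by
      have h : Continuous fun U : Matrix.unitaryGroup (Fin n) 𝕜 => U.1 * P ω' * star U.1 := by
        fun_prop
      have h' : Continuous fun U : Matrix.unitaryGroup (Fin n) 𝕜 =>
          (X ω, U.1 * P ω' * star U.1) := continuous_const.prodMk h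
      have h'' := (continuous_traceDeviation θ k).comp h'
      exact h''
    rw [← ofReal_integral_eq_lintegral_ofReal (integrable_unitary ρ hc)
      (Eventually.of_forall fun U => traceDeviation_nonneg _ _ _ _)]
    exact ENNReal.ofReal_le_ofReal (integral_traceDeviation_le ρ hθ k (hXh ω) (hPh ω')
      (hrank ω') (heig ω'))
  calc _ ≤ ∫⁻ _ω, ∫⁻ _ω', ENNReal.ofReal (quadFormConst / n ^ 2) ∂Pr ∂Pr :=
        lintegral_mono fun ω => lintegral_mono fun ω' => hle ω ω'
    _ = _ := by simp

/-- The expectations are summable, so the series of deviations is almost surely finite and its terms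
tend to `0`. The shift to `n + 1` avoids the empty matrix, which has no rank one perturbation. -/
lemma ae_tendsto_traceDeviation {X P : (n : ℕ) → Ω → Matrix (Fin n) (Fin n) 𝕜}
    (hX : ∀ n, Measurable (X n)) (hP : ∀ n, Measurable (P n))
    (hind : ∀ n, IndepFun (X n) (P n) Pr)
    (hinv : ∀ n, ConjInvariant Pr (X n) ∨ ConjInvariant Pr (P n)) {θ : ℝ} (hθ : θ ≠ 0)
    (hXh : ∀ n ω, (X n ω).IsHermitian) (hPh : ∀ n ω, (P n ω).IsHermitian)
    (hrank : ∀ n, 1 ≤ n → ∀ ω, (P n ω).rank = 1)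
    (heig : ∀ n, 1 ≤ n → ∀ ω, θ ∈ realEigenvalues (P n ω)) :
    ∀ᵐ ω ∂Pr, ∀ k, Tendsto (fun n => traceDeviation θ k (X n ω) (P n ω)) atTop (𝓝 0) := by
  rw [ae_all_iff]
  intro k
  have hm : ∀ n, Measurable fun ω => ENNReal.ofReal
      (traceDeviation θ k (X (n + 1) ω) (P (n + 1) ω)) := fun n =>
    ((continuous_traceDeviation θ k).measurable.comp
      ((hX (n + 1)).prodMk (hP (n + 1)))).ennreal_ofReal
  have hsum : ∫⁻ ω, ∑' n, ENNReal.ofReal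
      (traceDeviation θ k (X (n + 1) ω) (P (n + 1) ω)) ∂Pr ≠ ∞ := by
    rw [lintegral_tsum fun n => (hm n).aemeasurable]
    have hs : Summable fun n : ℕ => quadFormConst / ((n + 1 : ℕ) : ℝ) ^ 2 := by
      have := (summable_nat_add_iff 1).2 (Real.summable_one_div_nat_pow.2 one_lt_two)
      simpa [div_eq_mul_inv] using this.mul_left quadFormConst
    refine ne_top_of_le_ne_top hs.tsum_ofReal_ne_top (ENNReal.tsum_le_tsum fun n => ?_)
    exact lintegral_traceDeviation_le (hX _) (hP _) (hind _) (hinv _) hθ k (hXh _) (hPh _)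
      (hrank _ (by omega)) (heig _ (by omega))
  filter_upwards [ae_lt_top (Measurable.tsum hm) hsum] with ω hω
  have h := ENNReal.tendsto_atTop_zero_of_tsum_ne_top hω.ne
  rw [← tendsto_add_atTop_iff_nat 1]
  have h' := (ENNReal.tendsto_toReal ENNReal.zero_ne_top).comp h
  refine h'.congr fun n => ?_
  exact ENNReal.toReal_ofReal (traceDeviation_nonneg _ _ _ _)

end Concentration

/-! ### The `T`-transform near the edge of the support -/

section Edge

variable {ν : Measure ℝ} [IsProbabilityMeasure ν] {β M : ℝ}

lemma integrable_of_abs_le_of_lt (hβ : ∀ᵐ t ∂ν, t ≤ β) {g : ℝ → ℝ} (hg : Measurable g) (C : ℝ)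
    (h : ∀ t ≤ β, |g t| ≤ C) : Integrable g ν :=
  Integrable.of_bound hg.aestronglyMeasurable C (hβ.mono fun t ht => h t ht)

lemma abs_div_sub_le {z t : ℝ} (hz : β < z) (ht : t ≤ β) : |t / (z - t)| ≤ 1 + |z| / (z - β) := by
  have h1 : 0 < z - t := by linarith
  have h2 : t / (z - t) = z / (z - t) - 1 := by field_simp; ring
  rw [h2]
  have h3 : |z / (z - t)| ≤ |z| / (z - β) := by
    rw [abs_div, abs_of_pos h1]
    have : 0 < z - β := by linarith
    gcongr
  have := abs_sub (z / (z - t)) 1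
  rw [abs_one] at this
  linarith

lemma integrable_div_sub (hβ : ∀ᵐ t ∂ν, t ≤ β) {z : ℝ} (hz : β < z) :
    Integrable (fun t => t / (z - t)) ν :=
  integrable_of_abs_le_of_lt hβ (by fun_prop) _ fun _ ht => abs_div_sub_le hz ht

/-- The difference of the integrands is `θ t` times a positive factor. Requiring only `θ t ≥ 0`
covers both edges: `θ > 0` with positive `t`, and `θ < 0` with the reflected measure. -/
lemma tTransform_strictAnti (hβ : ∀ᵐ t ∂ν, t ≤ β) {θ : ℝ} (hpos : ∀ᵐ t ∂ν, 0 ≤ θ * t)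
    (hne : ¬ ∀ᵐ t ∂ν, t = 0) (hθ : θ ≠ 0) {z z' : ℝ} (hz : β < z) (hzz' : z < z') :
    θ * tTransform ν z' < θ * tTransform ν z := by
  have hi := integrable_div_sub hβ hz
  have hi' := integrable_div_sub hβ (hz.trans hzz')
  have e : ∀ t ≤ β, θ * (t / (z - t) - t / (z' - t)) =
      (θ * t) * ((z' - z) / ((z - t) * (z' - t))) := fun t ht => by
    have h1 : z - t ≠ 0 := by linarith
    have h2 : z' - t ≠ 0 := by linarith
    field_simp
    ring
  have hq : ∀ t ≤ β, 0 < (z' - z) / ((z - t) * (z' - t)) := fun t ht =>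
    div_pos (by linarith) (mul_pos (by linarith) (by linarith))
  have hnn : 0 ≤ᵐ[ν] fun t => θ * (t / (z - t) - t / (z' - t)) := by
    filter_upwards [hβ, hpos] with t ht h0
    rw [Pi.zero_apply, e t ht]
    exact mul_nonneg h0 (hq t ht).le
  have hint : Integrable (fun t => θ * (t / (z - t) - t / (z' - t))) ν :=
    (hi.sub hi').const_mul θ
  have h0 : 0 < ∫ t, θ * (t / (z - t) - t / (z' - t)) ∂ν := by
    refine (integral_nonneg_of_ae hnn).lt_of_ne fun h => hne ?_
    have := (integral_eq_zero_iff_of_nonneg_ae hnn hint).1 h.symm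
    filter_upwards [this, hβ] with t ht hle
    rw [Pi.zero_apply, e t hle, mul_eq_zero] at ht
    rcases ht with ht | ht
    · exact (mul_eq_zero.1 ht).resolve_left hθ
    · exact absurd ht (hq t hle).ne'
  rw [integral_const_mul, integral_sub hi hi', mul_sub] at h0
  unfold tTransform
  linarith

/-- Formally `-T'` is the integral of `t / (z - t)²`, which is comparable to that of `(t / (z -
t))²` when the edge is not `0`. If the latter stayed bounded, `T` would be Lipschitz to the right of
`β` and its derivative could not blow up; no differentiation under the integral is needed. -/
lemma exists_lt_integral_sq_div_sub (hβ : ∀ᵐ t ∂ν, t ≤ β) (hM : ∀ᵐ t ∂ν, |t| ≤ M) (hβ0 : β ≠ 0)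
    (hder : Tendsto (fun z => |deriv (tTransform ν) z|) (𝓝[>] β) atTop) (K : ℝ) :
    ∃ z > β, K < ∫ t, (t / (z - t)) ^ 2 ∂ν := by
  by_contra! hK
  have hβpos : 0 < |β| := abs_pos.2 hβ0
  have hM0 : 0 ≤ M := by
    obtain ⟨t, ht⟩ := hM.exists
    exact (abs_nonneg t).trans ht
  set K' := 2 / |β| * K + M * (4 / β ^ 2) with hK'
  have hpt : ∀ z > β, ∀ t ≤ β, |t| ≤ M →
      |t| / (z - t) ^ 2 ≤ 2 / |β| * (t / (z - t)) ^ 2 + M * (4 / β ^ 2) := by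
    intro z hz t ht htM
    have hzt : 0 < z - t := by linarith
    have hz2 : 0 < (z - t) ^ 2 := by positivity
    -- For `|t| ≥ |β| / 2` one factor `|t|` costs `2 / |β|`; otherwise `t` is at distance at least
    -- `|β| / 2` from `z`.
    rcases le_or_gt (|β| / 2) |t| with h | h
    · have h1 : |t| / (z - t) ^ 2 ≤ 2 / |β| * (t / (z - t)) ^ 2 := by
        rw [div_pow, ← sq_abs t, ← mul_div_assoc]
        gcongr
        rw [div_mul_eq_mul_div, le_div_iff₀ hβpos]
        nlinarith [abs_nonneg t]
      have : 0 ≤ M * (4 / β ^ 2) := by positivity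
      linarith
    · have hb : |β| / 2 ≤ z - t := by
        rcases le_or_gt 0 β with h0 | h0
        · rw [abs_of_nonneg h0] at h ⊢
          linarith [le_abs_self t]
        · rw [abs_of_neg h0] at h
          linarith [neg_abs_le t]
      have h1 : |t| / (z - t) ^ 2 ≤ M * (4 / β ^ 2) := by
        rw [div_le_iff₀ hz2]
        have h2 : β ^ 2 / 4 ≤ (z - t) ^ 2 := by
          rw [← sq_abs β]; nlinarith
        have h3 : 1 ≤ 4 / β ^ 2 * (z - t) ^ 2 := by
          rw [div_mul_eq_mul_div, le_div_iff₀ (by positivity)]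
          linarith
        nlinarith
      have : 0 ≤ 2 / |β| * (t / (z - t)) ^ 2 := by positivity
      linarith
  have hsqi : ∀ z > β, Integrable (fun t => (t / (z - t)) ^ 2) ν := fun z hz =>
    integrable_of_abs_le_of_lt hβ (by fun_prop) ((1 + |z| / (z - β)) ^ 2) fun t ht => by
      rw [abs_pow]
      exact pow_le_pow_left₀ (abs_nonneg _) (abs_div_sub_le hz ht) 2
  have hri : ∀ z > β, Integrable (fun t => 2 / |β| * (t / (z - t)) ^ 2 + M * (4 / β ^ 2)) ν :=
    fun z hz => ((hsqi z hz).const_mul _).add (integrable_const _)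
  have hbound : ∀ z > β, ∫ t, (2 / |β| * (t / (z - t)) ^ 2 + M * (4 / β ^ 2)) ∂ν ≤ K' := by
    intro z hz
    rw [integral_add ((hsqi z hz).const_mul _) (integrable_const _), integral_const_mul]
    simp only [integral_const, probReal_univ, smul_eq_mul, one_mul]
    rw [hK']
    gcongr
    exact hK z hz
  have hK'0 : 0 ≤ K' := (integral_nonneg fun t => by positivity).trans
    (hbound (β + 1) (by linarith))
  have hlip : LipschitzOnWith ⟨K', hK'0⟩ (tTransform ν) (Set.Ioi β) := by
    refine LipschitzOnWith.of_dist_le_mul fun z hz z' hz' => ?_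
    rw [Real.dist_eq, Real.dist_eq]
    change |_| ≤ K' * |z - z'|
    unfold tTransform
    rw [← integral_sub (integrable_div_sub hβ hz) (integrable_div_sub hβ hz')]
    have hle : ∀ᵐ t ∂ν, ‖t / (z - t) - t / (z' - t)‖ ≤
        |z - z'| / 2 * ((2 / |β| * (t / (z - t)) ^ 2 + M * (4 / β ^ 2)) +
          (2 / |β| * (t / (z' - t)) ^ 2 + M * (4 / β ^ 2))) := by
      filter_upwards [hβ, hM] with t ht htM
      have h1 : 0 < z - t := by linarith [Set.mem_Ioi.1 hz]
      have h2 : 0 < z' - t := by linarith [Set.mem_Ioi.1 hz']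
      have e : t / (z - t) - t / (z' - t) = (z' - z) * (t * ((z - t)⁻¹ * (z' - t)⁻¹)) := by
        field_simp
        ring
      have hp := hpt z hz t ht htM
      have hp' := hpt z' hz' t ht htM
      rw [e, Real.norm_eq_abs, abs_mul, abs_mul, abs_sub_comm z' z, div_mul_eq_mul_div,
        mul_div_assoc, abs_of_pos (by positivity : 0 < (z - t)⁻¹ * (z' - t)⁻¹)]
      gcongr
      -- Symmetrising by the arithmetic–geometric mean inequality separates `z` from `z'`.
      have h3 : (z - t)⁻¹ * (z' - t)⁻¹ ≤ (((z - t) ^ 2)⁻¹ + ((z' - t) ^ 2)⁻¹) / 2 := by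
        rw [← inv_pow, ← inv_pow]
        nlinarith [sq_nonneg ((z - t)⁻¹ - (z' - t)⁻¹)]
      calc |t| * ((z - t)⁻¹ * (z' - t)⁻¹) ≤ |t| * ((((z - t) ^ 2)⁻¹ + ((z' - t) ^ 2)⁻¹) / 2) := by
            gcongr
        _ = (|t| / (z - t) ^ 2 + |t| / (z' - t) ^ 2) / 2 := by ring
        _ ≤ _ := by linarith
    refine (norm_integral_le_of_norm_le (((hri z hz).add (hri z' hz')).const_mul _) hle).trans ?_
    rw [integral_const_mul, integral_add' (hri z hz) (hri z' hz')]
    have := hbound z hz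
    have := hbound z' hz'
    nlinarith [abs_nonneg (z - z')]
  obtain ⟨z, hz, hzβ⟩ := ((hder.eventually_gt_atTop K').and self_mem_nhdsWithin).exists
  have := norm_deriv_le_of_lipschitzOn (Ioi_mem_nhds hzβ) hlip
  exact absurd (lt_of_lt_of_le hz this) (lt_irrefl _)

lemma tTransform_map_neg (μ : Measure ℝ) (z : ℝ) :
    tTransform (μ.map fun t => -t) z = tTransform μ (-z) := by
  unfold tTransform
  rw [integral_map (by fun_prop) (by
    exact (by fun_prop : Measurable fun t : ℝ => t / (z - t)).aestronglyMeasurable)]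
  congr 1
  ext t
  rw [← neg_div_neg_eq]
  congr 1 <;> ring

end Edge

/-! ### Overlap of an eigenvector with the direction of the perturbation -/

section Overlap

variable {𝕜 : Type*} [RCLike 𝕜]

/-- The secular equation first confines `y` to the left of `β + ε / 2`. Then `|y - x i| ≤ β + ε - x
i`, so the eigenvector equation bounds `|u i|` from below by the kernel at the fixed point `β + ε`.
-/
lemma norm_sq_overlap_le {ι : Type*} [Fintype ι] {x : ι → ℝ} {u v : ι → 𝕜} {c : 𝕜}
    {y θ β ε K : ℝ} (hε : 0 < ε) (hc : c = ∑ i, star (v i) * u i) (hu : ∑ i, ‖u i‖ ^ 2 = 1)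
    (heq : ∀ i, ((y - x i : ℝ) : 𝕜) * u i = ((θ * x i : ℝ) : 𝕜) * c * v i)
    (hθx : ∀ i, 0 ≤ θ * x i) (hx : ∀ i, x i ≤ β + ε / 3) (hy : β - ε / 3 ≤ y)
    (hsub : θ * ∑ i, ‖v i‖ ^ 2 * (x i / (β + ε / 2 - x i)) < 1)
    (hK : K ≤ ∑ i, ‖v i‖ ^ 2 * (x i / (β + ε - x i)) ^ 2) :
    θ ^ 2 * ‖c‖ ^ 2 * K ≤ 1 := by
  by_cases hc0 : c = 0
  · simp [hc0]
  have hyle : y < β + ε / 2 := by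
    -- Here `y` exceeds all `x i`, so the equation can be solved for `u`. Pairing with `v` and
    -- cancelling `c` gives the secular equation, contradicting `hsub` by monotonicity.
    by_contra! hge
    have hu' : ∀ i, star (v i) * u i =
        c * ((θ * (‖v i‖ ^ 2 * (x i / (y - x i))) : ℝ) : 𝕜) := fun i => by
      have hpos : (y - x i : ℝ) ≠ 0 := by linarith [hx i]
      have hpos' : ((y - x i : ℝ) : 𝕜) ≠ 0 := by exact_mod_cast hpos
      have h1 : u i = ((θ * x i / (y - x i) : ℝ) : 𝕜) * c * v i := by
        have := heq i
        apply mul_left_cancel₀ hpos'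
        rw [this, ← mul_assoc, ← mul_assoc, ← RCLike.ofReal_mul, mul_div_cancel₀ _ hpos]
      have h2 : star (v i) * v i = ((‖v i‖ ^ 2 : ℝ) : 𝕜) := by
        rw [RCLike.star_def, RCLike.conj_mul]; norm_cast
      calc star (v i) * u i = ((θ * x i / (y - x i) : ℝ) : 𝕜) * c * (star (v i) * v i) := by
            rw [h1]; ring
        _ = _ := by rw [h2]; push_cast; ring
    have h1 : (1 : 𝕜) = ((θ * ∑ i, ‖v i‖ ^ 2 * (x i / (y - x i)) : ℝ) : 𝕜) := by
      apply mul_left_cancel₀ hc0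
      rw [mul_one]
      nth_rewrite 1 [hc]
      simp_rw [hu']
      rw [← Finset.mul_sum, ← RCLike.ofReal_sum, ← Finset.mul_sum]
    have h1' : (1 : ℝ) = θ * ∑ i, ‖v i‖ ^ 2 * (x i / (y - x i)) := by exact_mod_cast h1
    have h2 : θ * ∑ i, ‖v i‖ ^ 2 * (x i / (y - x i)) ≤
        θ * ∑ i, ‖v i‖ ^ 2 * (x i / (β + ε / 2 - x i)) := by
      rw [Finset.mul_sum, Finset.mul_sum]
      refine Finset.sum_le_sum fun i _ => ?_
      have e : ∀ d, θ * (‖v i‖ ^ 2 * (x i / d)) = ‖v i‖ ^ 2 * (θ * x i / d) := fun d => by ring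
      have hp : 0 < β + ε / 2 - x i := by linarith [hx i]
      rw [e, e]
      have := hθx i
      gcongr
    linarith
  have hterm : ∀ i, θ ^ 2 * ‖c‖ ^ 2 * (‖v i‖ ^ 2 * (x i / (β + ε - x i)) ^ 2) ≤ ‖u i‖ ^ 2 :=
    fun i => by
      have hp : 0 < β + ε - x i := by linarith [hx i]
      have hn := congrArg (fun w : 𝕜 => ‖w‖ ^ 2) (heq i)
      simp only [norm_mul, mul_pow, RCLike.norm_ofReal, sq_abs] at hn
      -- The lower side is `2 x i ≤ y + β + ε`, which is exactly what the two margins `ε / 3`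
      -- provide.
      have hab : (y - x i) ^ 2 ≤ (β + ε - x i) ^ 2 := by
        apply sq_le_sq'
        · linarith [hx i]
        · linarith
      calc θ ^ 2 * ‖c‖ ^ 2 * (‖v i‖ ^ 2 * (x i / (β + ε - x i)) ^ 2)
          = (y - x i) ^ 2 * ‖u i‖ ^ 2 / (β + ε - x i) ^ 2 := by
            rw [hn, div_pow]; ring
        _ ≤ (β + ε - x i) ^ 2 * ‖u i‖ ^ 2 / (β + ε - x i) ^ 2 := by gcongr
        _ = ‖u i‖ ^ 2 := by field_simp
  calc θ ^ 2 * ‖c‖ ^ 2 * K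
      ≤ θ ^ 2 * ‖c‖ ^ 2 * ∑ i, ‖v i‖ ^ 2 * (x i / (β + ε - x i)) ^ 2 := by gcongr
    _ ≤ ∑ i, ‖u i‖ ^ 2 := by
      rw [Finset.mul_sum]
      exact Finset.sum_le_sum fun i _ => hterm i
    _ = 1 := hu

/-- The function `t / (z - t)`, frozen to the right of `m < z`. -/
noncomputable def truncatedKernel (m z : ℝ) (h : m < z) : BoundedContinuousFunction ℝ ℝ :=
  BoundedContinuousFunction.ofNormedAddCommGroup (fun t => min t m / (z - min t m))
    (Continuous.div (by fun_prop) (by fun_prop) fun t => by linarith [min_le_right t m])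
    (1 + |z| / (z - m)) fun t => abs_div_sub_le h (min_le_right t m)

lemma truncatedKernel_apply {m z : ℝ} (h : m < z) {t : ℝ} (ht : t ≤ m) :
    truncatedKernel m z h t = t / (z - t) := by
  simp [truncatedKernel, min_eq_left ht]

lemma tendsto_overlap_of_edge {x : (n : ℕ) → Fin n → ℝ} {u v : (n : ℕ) → Fin n → 𝕜}
    {c : ℕ → 𝕜} {y : ℕ → ℝ} {ν : Measure ℝ} {θ β : ℝ} (hθ : θ ≠ 0)
    (hconv : ∀ f : BoundedContinuousFunction ℝ ℝ,
      Tendsto (fun n => ∑ i, ‖v n i‖ ^ 2 * f (x n i)) atTop (𝓝 (∫ t, f t ∂ν)))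
    (hβ : ∀ᵐ t ∂ν, t ≤ β)
    (hc : ∀ n, 1 ≤ n → c n = ∑ i, star (v n i) * u n i)
    (hu : ∀ n, 1 ≤ n → ∑ i, ‖u n i‖ ^ 2 = 1)
    (heq : ∀ n, 1 ≤ n → ∀ i,
      ((y n - x n i : ℝ) : 𝕜) * u n i = ((θ * x n i : ℝ) : 𝕜) * c n * v n i)
    (hθx : ∀ n i, 0 ≤ θ * x n i) (hx : ∀ ε > 0, ∀ᶠ n in atTop, ∀ i, x n i ≤ β + ε)
    (hy : ∀ ε > 0, ∀ᶠ n in atTop, β - ε ≤ y n)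
    (hsub : ∀ z > β, θ * tTransform ν z < 1)
    (hdiv : ∀ K, ∃ z > β, K < ∫ t, (t / (z - t)) ^ 2 ∂ν) :
    Tendsto (fun n => ‖c n‖) atTop (𝓝 0) := by
  rw [Metric.tendsto_nhds]
  intro η hη
  -- With this threshold the overlap bound reads `‖c n‖² ≤ η² / 2`.
  obtain ⟨z, hz, hKz⟩ := hdiv (2 / (θ ^ 2 * η ^ 2))
  obtain ⟨ε, hε, rfl⟩ : ∃ ε > 0, z = β + ε := ⟨z - β, by linarith, by ring⟩
  have hm : β + ε / 3 < β + ε / 2 := by linarith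
  have hm' : β + ε / 3 < β + ε := by linarith
  have h1 := (hconv (truncatedKernel _ _ hm)).const_mul θ
  have h2 := hconv (truncatedKernel _ _ hm' * truncatedKernel _ _ hm')
  have e1 : ∫ t, truncatedKernel _ _ hm t ∂ν = tTransform ν (β + ε / 2) :=
    integral_congr_ae (hβ.mono fun t ht => truncatedKernel_apply hm (by linarith))
  have e2 : ∫ t, (truncatedKernel _ _ hm' * truncatedKernel _ _ hm') t ∂ν =
      ∫ t, (t / (β + ε - t)) ^ 2 ∂ν :=
    integral_congr_ae (hβ.mono fun t ht => by
      simp only [BoundedContinuousFunction.coe_mul, Pi.mul_apply]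
      rw [truncatedKernel_apply hm' (by linarith), sq])
  rw [e1] at h1
  rw [e2] at h2
  filter_upwards [h1.eventually_lt_const (hsub _ (by linarith)), h2.eventually_const_lt hKz,
    hx (ε / 3) (by linarith), hy (ε / 3) (by linarith), eventually_ge_atTop 1]
    with n hn1 hn2 hnx hny hn
  have hs1 : ∑ i, ‖v n i‖ ^ 2 * truncatedKernel _ _ hm (x n i) =
      ∑ i, ‖v n i‖ ^ 2 * (x n i / (β + ε / 2 - x n i)) :=
    Finset.sum_congr rfl fun i _ => by rw [truncatedKernel_apply hm (hnx i)]
  have hs2 : ∑ i, ‖v n i‖ ^ 2 * (truncatedKernel _ _ hm' * truncatedKernel _ _ hm') (x n i) =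
      ∑ i, ‖v n i‖ ^ 2 * (x n i / (β + ε - x n i)) ^ 2 :=
    Finset.sum_congr rfl fun i _ => by
      simp only [BoundedContinuousFunction.coe_mul, Pi.mul_apply]
      rw [truncatedKernel_apply hm' (hnx i), ← sq]
  rw [hs1] at hn1
  rw [hs2] at hn2
  have := norm_sq_overlap_le hε (hc n hn) (hu n hn) (heq n hn) (hθx n) hnx hny hn1 hn2.le
  have hθ2 : 0 < θ ^ 2 := by positivity
  rw [mul_div_assoc', div_le_one (by positivity)] at this
  rw [dist_zero_right, norm_norm]
  refine lt_of_pow_lt_pow_left₀ 2 hη.le ?_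
  nlinarith [norm_nonneg (c n), mul_pos hθ2 (pow_pos hη 2)]

/-- When `x i > δ` the gap `x i - y` is at least `(1 - θ) / 2 * x i`, so these coordinates supply at
most the fraction `-2θ / (1 - θ) < 1` of `c`. The remaining fraction `(1 + θ) / (1 - θ)` comes from
`x i ≤ δ` and is bounded by Cauchy–Schwarz. -/
lemma norm_sq_overlap_le_near {ι : Type*} [Fintype ι] {x : ι → ℝ} {u v : ι → 𝕜} {c : 𝕜}
    {y θ δ : ℝ} (hδ : 0 < δ) (hθ0 : θ < 0) (hθ1 : -1 < θ) (hc : c = ∑ i, star (v i) * u i)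
    (hu : ∑ i, ‖u i‖ ^ 2 = 1) (hv : ∑ i, ‖v i‖ ^ 2 = 1)
    (heq : ∀ i, ((y - x i : ℝ) : 𝕜) * u i = ((θ * x i : ℝ) : 𝕜) * c * v i)
    (hy : y ≤ (1 + θ) / 2 * δ) :
    ((1 + θ) / (1 - θ)) ^ 2 * ‖c‖ ^ 2 ≤ ∑ i with x i ≤ δ, ‖v i‖ ^ 2 := by
  have hfar : ∀ i, ¬ x i ≤ δ →
      ‖star (v i) * u i‖ ≤ ‖c‖ * (-θ / ((1 - θ) / 2)) * ‖v i‖ ^ 2 := fun i hi => by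
    push Not at hi
    have hxp : 0 < x i := hδ.trans hi
    have hd : (1 - θ) / 2 * x i ≤ x i - y := by nlinarith
    have hdpos : 0 < (1 - θ) / 2 * x i := by nlinarith
    have hn := congrArg norm (heq i)
    rw [norm_mul, norm_mul, norm_mul, RCLike.norm_ofReal, RCLike.norm_ofReal, abs_sub_comm,
      abs_of_pos (by linarith : 0 < x i - y), abs_mul, abs_of_neg hθ0, abs_of_pos hxp] at hn
    have h1 : (1 - θ) / 2 * ‖u i‖ ≤ -θ * ‖c‖ * ‖v i‖ := by
      have : (1 - θ) / 2 * x i * ‖u i‖ ≤ -θ * x i * ‖c‖ * ‖v i‖ := by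
        rw [← hn]; gcongr
      nlinarith
    have h2 : ‖u i‖ ≤ ‖c‖ * (-θ / ((1 - θ) / 2)) * ‖v i‖ := by
      rw [mul_div_assoc', div_mul_eq_mul_div, le_div_iff₀ (by linarith)]
      linarith
    rw [norm_mul, norm_star]
    nlinarith [norm_nonneg (v i)]
  have hsplit := Finset.sum_filter_add_sum_filter_not Finset.univ (fun i => x i ≤ δ)
    (fun i => star (v i) * u i)
  rw [← hc] at hsplit
  have hF : ‖∑ i with ¬ x i ≤ δ, star (v i) * u i‖ ≤ ‖c‖ * (-θ / ((1 - θ) / 2)) := by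
    calc _ ≤ ∑ i with ¬ x i ≤ δ, ‖c‖ * (-θ / ((1 - θ) / 2)) * ‖v i‖ ^ 2 :=
          norm_sum_le_of_le _ fun i hi => hfar i (Finset.mem_filter.1 hi).2
      _ ≤ ∑ i, ‖c‖ * (-θ / ((1 - θ) / 2)) * ‖v i‖ ^ 2 := by
          refine Finset.sum_le_sum_of_subset_of_nonneg (Finset.subset_univ _) fun i _ _ => ?_
          have : 0 ≤ -θ / ((1 - θ) / 2) := div_nonneg (by linarith) (by linarith)
          positivity
      _ = _ := by rw [← Finset.mul_sum, hv, mul_one]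
  have hN : ‖∑ i with x i ≤ δ, star (v i) * u i‖ ^ 2 ≤ ∑ i with x i ≤ δ, ‖v i‖ ^ 2 := by
    calc _ ≤ (∑ i with x i ≤ δ, ‖v i‖ * ‖u i‖) ^ 2 := by
          gcongr
          exact norm_sum_le_of_le _ fun i _ => (by rw [norm_mul, norm_star])
      _ ≤ (∑ i with x i ≤ δ, ‖v i‖ ^ 2) * ∑ i with x i ≤ δ, ‖u i‖ ^ 2 :=
          Finset.sum_mul_sq_le_sq_mul_sq _ _ _
      _ ≤ (∑ i with x i ≤ δ, ‖v i‖ ^ 2) * ∑ i, ‖u i‖ ^ 2 := by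
          refine mul_le_mul_of_nonneg_left ?_ (Finset.sum_nonneg fun i _ => sq_nonneg _)
          exact Finset.sum_le_sum_of_subset_of_nonneg (Finset.subset_univ _)
            fun i _ _ => sq_nonneg _
      _ = _ := by rw [hu, mul_one]
  refine le_trans ?_ hN
  rw [← mul_pow]
  have hγ : 0 ≤ (1 + θ) / (1 - θ) := div_nonneg (by linarith) (by linarith)
  refine pow_le_pow_left₀ (by positivity) ?_ 2
  have h3 : ‖c‖ ≤ ‖∑ i with x i ≤ δ, star (v i) * u i‖ +
      ‖∑ i with ¬ x i ≤ δ, star (v i) * u i‖ := by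
    nth_rewrite 1 [← hsplit]
    exact norm_add_le _ _
  have h4 : (1 + θ) / (1 - θ) * ‖c‖ = ‖c‖ - ‖c‖ * (-θ / ((1 - θ) / 2)) := by
    have : 1 - θ ≠ 0 := by linarith
    field_simp
    ring
  linarith

/-- A continuous cutoff, equal to `1` on `(-∞, δ]` and to `0` on `[2 * δ, ∞)`. -/
noncomputable def leftCutoff (δ : ℝ) : BoundedContinuousFunction ℝ ℝ :=
  BoundedContinuousFunction.ofNormedAddCommGroup (fun t => max 0 (min 1 (2 - t / δ)))
    (by fun_prop) 1 fun t => by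
      rw [Real.norm_eq_abs, abs_of_nonneg (le_max_left _ _)]
      exact max_le zero_le_one (min_le_left _ _)

lemma leftCutoff_apply (δ t : ℝ) : leftCutoff δ t = max 0 (min 1 (2 - t / δ)) := rfl

/-- As `δ → 0` the cutoffs vanish at every `t > 0`, so dominated convergence applies in the absence
of an atom at `0`. -/
lemma exists_integral_leftCutoff_lt {μ : Measure ℝ} [IsProbabilityMeasure μ]
    (hpos : ∀ᵐ t ∂μ, 0 ≤ t) (h0 : μ {0} = 0) {η : ℝ} (hη : 0 < η) :
    ∃ δ > 0, ∫ t, leftCutoff δ t ∂μ < η := by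
  have hne : ∀ᵐ t ∂μ, t ≠ 0 := by
    rw [ae_iff]
    simpa using h0
  have hlim : Tendsto (fun m : ℕ => ∫ t, leftCutoff (1 / ((m : ℝ) + 1)) t ∂μ) atTop
      (𝓝 (∫ _t, (0 : ℝ) ∂μ)) := by
    refine tendsto_integral_of_dominated_convergence (fun _ => 1)
      (fun m => (leftCutoff _).continuous.aestronglyMeasurable) (integrable_const _)
      (fun m => Eventually.of_forall fun t => ?_) ?_
    · rw [leftCutoff_apply, Real.norm_eq_abs, abs_of_nonneg (le_max_left _ _)]
      exact max_le zero_le_one (min_le_left _ _)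
    · filter_upwards [hpos, hne] with t ht ht0
      have htp : 0 < t := lt_of_le_of_ne ht (Ne.symm ht0)
      refine tendsto_const_nhds.congr' ?_
      have := tendsto_natCast_atTop_atTop (R := ℝ)
      filter_upwards [this.eventually_ge_atTop (2 / t)] with m hm
      rw [leftCutoff_apply, eq_comm]
      refine max_eq_left ((min_le_right _ _).trans ?_)
      rw [div_le_iff₀ htp] at hm
      rw [div_div_eq_mul_div, div_one]
      nlinarith
  rw [integral_zero] at hlim
  obtain ⟨m, hm⟩ := (hlim.eventually_lt_const hη).exists
  exact ⟨_, by positivity, hm⟩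

lemma tendsto_overlap_of_edge_zero {x : (n : ℕ) → Fin n → ℝ} {u v : (n : ℕ) → Fin n → 𝕜}
    {c : ℕ → 𝕜} {y : ℕ → ℝ} {μ : Measure ℝ} [IsProbabilityMeasure μ] {θ : ℝ} (hθ0 : θ < 0)
    (hθ1 : -1 < θ)
    (hconv : ∀ f : BoundedContinuousFunction ℝ ℝ,
      Tendsto (fun n => ∑ i, ‖v n i‖ ^ 2 * f (x n i)) atTop (𝓝 (∫ t, f t ∂μ)))
    (hpos : ∀ᵐ t ∂μ, 0 ≤ t) (hatom : μ {0} = 0)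
    (hc : ∀ n, 1 ≤ n → c n = ∑ i, star (v n i) * u n i)
    (hu : ∀ n, 1 ≤ n → ∑ i, ‖u n i‖ ^ 2 = 1) (hv : ∀ n, 1 ≤ n → ∑ i, ‖v n i‖ ^ 2 = 1)
    (heq : ∀ n, 1 ≤ n → ∀ i,
      ((y n - x n i : ℝ) : 𝕜) * u n i = ((θ * x n i : ℝ) : 𝕜) * c n * v n i)
    (hy : ∀ ε > 0, ∀ᶠ n in atTop, y n ≤ ε) :
    Tendsto (fun n => ‖c n‖) atTop (𝓝 0) := by
  rw [Metric.tendsto_nhds]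
  intro η hη
  have hγ : 0 < (1 + θ) / (1 - θ) := div_pos (by linarith) (by linarith)
  obtain ⟨δ, hδ, hlt⟩ := exists_integral_leftCutoff_lt hpos hatom
    (η := ((1 + θ) / (1 - θ)) ^ 2 * η ^ 2) (by positivity)
  filter_upwards [(hconv (leftCutoff δ)).eventually_lt_const hlt,
    hy ((1 + θ) / 2 * δ) (mul_pos (by linarith) hδ), eventually_ge_atTop 1] with n hn1 hny hn
  have h1 := norm_sq_overlap_le_near hδ hθ0 hθ1 (hc n hn) (hu n hn) (hv n hn) (heq n hn) hny
  have h2 : ∑ i with x n i ≤ δ, ‖v n i‖ ^ 2 ≤ ∑ i, ‖v n i‖ ^ 2 * leftCutoff δ (x n i) := by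
    rw [Finset.sum_filter]
    refine Finset.sum_le_sum fun i _ => ?_
    split_ifs with h
    · have : leftCutoff δ (x n i) = 1 := by
        have h' : x n i / δ ≤ 1 := (div_le_one hδ).2 h
        rw [leftCutoff_apply, min_eq_left (by linarith), max_eq_right zero_le_one]
      rw [this, mul_one]
    · exact mul_nonneg (sq_nonneg _) (le_max_left _ _)
  rw [dist_zero_right, norm_norm]
  refine lt_of_pow_lt_pow_left₀ 2 hη.le ?_
  exact lt_of_mul_lt_mul_left (h1.trans_lt (h2.trans_lt hn1)) (by positivity)

end Overlap

/-! ### Weak convergence of the spectral measure seen from the perturbation -/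

section SpectralConvergence

variable {𝕜 : Type*} [RCLike 𝕜]

lemma traceDeviation_eq {n : ℕ} {A : Matrix (Fin n) (Fin n) 𝕜} (hA : A.IsHermitian) {θ : ℝ}
    (hθ : θ ≠ 0) (v : Fin n → 𝕜) (k : ℕ) :
    traceDeviation θ k A ((θ : 𝕜) • Matrix.vecMulVec v (star v)) =
      (∑ i, ‖eigenCoord hA v i‖ ^ 2 * hA.eigenvalues i ^ k -
        (∑ i, hA.eigenvalues i ^ k) / n) ^ 4 /
        (1 + ((∑ i, hA.eigenvalues i ^ (2 * k)) / n) ^ 2) := by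
  unfold traceDeviation
  rw [trace_rankOne_mul, star_dotProduct_pow_mulVec hA, trace_pow_eq_sum hA, trace_pow_eq_sum hA,
    RCLike.re_ofReal_mul, RCLike.ofReal_re, RCLike.ofReal_re, RCLike.ofReal_re,
    mul_div_cancel_left₀ _ hθ]
  simp_rw [mul_comm (‖_‖ ^ 2)]

variable {A : (n : ℕ) → Matrix (Fin n) (Fin n) 𝕜} (hA : ∀ n, (A n).IsHermitian)
  {v : (n : ℕ) → Fin n → 𝕜} {θ R : ℝ}

lemma tendsto_moment_sub (hθ : θ ≠ 0)
    (hR : ∀ᶠ n in atTop, ∀ i, |(hA n).eigenvalues i| ≤ R) (k : ℕ)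
    (hdev : Tendsto (fun n => traceDeviation θ k (A n)
      ((θ : 𝕜) • Matrix.vecMulVec (v n) (star (v n)))) atTop (𝓝 0)) :
    Tendsto (fun n => ∑ i, ‖eigenCoord (hA n) (v n) i‖ ^ 2 * (hA n).eigenvalues i ^ k -
      (∑ i, (hA n).eigenvalues i ^ k) / n) atTop (𝓝 0) := by
  set d : ℕ → ℝ := fun n => ∑ i, ‖eigenCoord (hA n) (v n) i‖ ^ 2 * (hA n).eigenvalues i ^ k -
      (∑ i, (hA n).eigenvalues i ^ k) / n with hd
  have h4 : Tendsto (fun n => d n ^ 4) atTop (𝓝 0) := by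
    -- Eventually bounded eigenvalues bound the normalising denominator, which can then be
    -- multiplied away.
    have hup := hdev.mul_const (1 + (R ^ (2 * k)) ^ 2)
    rw [zero_mul] at hup
    refine tendsto_of_tendsto_of_tendsto_of_le_of_le' tendsto_const_nhds hup
      (Eventually.of_forall fun n => by positivity) ?_
    filter_upwards [hR, eventually_ge_atTop 1] with n hn hn1
    have hnpos : (0 : ℝ) < n := by exact_mod_cast hn1
    have hs0 : 0 ≤ (∑ i, (hA n).eigenvalues i ^ (2 * k)) / n :=
      div_nonneg (Finset.sum_nonneg fun i _ => by rw [pow_mul]; positivity) hnpos.le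
    have hs : (∑ i, (hA n).eigenvalues i ^ (2 * k)) / n ≤ R ^ (2 * k) := by
      rw [div_le_iff₀ hnpos]
      calc _ ≤ ∑ _i : Fin n, R ^ (2 * k) := Finset.sum_le_sum fun i _ => by
            calc (hA n).eigenvalues i ^ (2 * k) = |(hA n).eigenvalues i| ^ (2 * k) := by
                  rw [pow_mul, pow_mul, sq_abs]
              _ ≤ _ := pow_le_pow_left₀ (abs_nonneg _) (hn i) _
        _ = _ := by simp [mul_comm]
    rw [traceDeviation_eq (hA n) hθ]
    change d n ^ 4 ≤ d n ^ 4 / _ * _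
    rw [div_mul_eq_mul_div, le_div_iff₀ (by positivity)]
    gcongr
  rw [tendsto_zero_iff_abs_tendsto_zero]
  have := h4.sqrt.sqrt
  simp only [Real.sqrt_zero] at this
  refine this.congr fun n => ?_
  rw [show d n ^ 4 = (d n ^ 2) ^ 2 by ring, Real.sqrt_sq (sq_nonneg _), Real.sqrt_sq_eq_abs]
  rfl

lemma tendsto_polynomial_sub (hθ : θ ≠ 0)
    (hR : ∀ᶠ n in atTop, ∀ i, |(hA n).eigenvalues i| ≤ R)
    (hdev : ∀ k, Tendsto (fun n => traceDeviation θ k (A n)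
      ((θ : 𝕜) • Matrix.vecMulVec (v n) (star (v n)))) atTop (𝓝 0)) (p : Polynomial ℝ) :
    Tendsto (fun n => ∑ i, ‖eigenCoord (hA n) (v n) i‖ ^ 2 * p.eval ((hA n).eigenvalues i) -
      (∑ i, p.eval ((hA n).eigenvalues i)) / n) atTop (𝓝 0) := by
  have h := tendsto_finsetSum (Finset.range (p.natDegree + 1)) fun k _ =>
    (tendsto_moment_sub hA hθ hR k (hdev k)).const_mul (p.coeff k)
  simp only [mul_zero, Finset.sum_const_zero] at h
  refine h.congr fun n => ?_
  simp_rw [Polynomial.eval_eq_sum_range, mul_sub, Finset.sum_sub_distrib, Finset.mul_sum,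
    Finset.sum_div, Finset.mul_sum]
  congr 1
  · rw [Finset.sum_comm]
    exact Finset.sum_congr rfl fun i _ => Finset.sum_congr rfl fun k _ => by ring
  · rw [Finset.sum_comm]
    exact Finset.sum_congr rfl fun i _ => Finset.sum_congr rfl fun k _ => by ring

lemma integral_empiricalSpectralMeasure {n : ℕ} {B : Matrix (Fin n) (Fin n) 𝕜}
    (hB : B.IsHermitian) (f : BoundedContinuousFunction ℝ ℝ) :
    ∫ t, f t ∂(empiricalSpectralMeasure hB) = (∑ i, f (hB.eigenvalues i)) / n := by
  unfold empiricalSpectralMeasure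
  rw [integral_smul_measure, integral_finsetSum_measure fun i _ => f.integrable _]
  simp [div_eq_inv_mul]

/-- If the moments concentrate, the weighted spectral measure has the same weak limit as the
empirical spectral measure. -/
lemma tendsto_weighted_spectral (hθ : θ ≠ 0) (hv : ∀ n, 1 ≤ n → ∑ i, ‖v n i‖ ^ 2 = 1)
    (hR : ∀ᶠ n in atTop, ∀ i, |(hA n).eigenvalues i| ≤ R)
    (hdev : ∀ k, Tendsto (fun n => traceDeviation θ k (A n)
      ((θ : 𝕜) • Matrix.vecMulVec (v n) (star (v n)))) atTop (𝓝 0))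
    {μ : Measure ℝ} (hweak : WeaklyConverges (fun n => empiricalSpectralMeasure (hA n)) μ)
    (f : BoundedContinuousFunction ℝ ℝ) :
    Tendsto (fun n => ∑ i, ‖eigenCoord (hA n) (v n) i‖ ^ 2 * f ((hA n).eigenvalues i)) atTop
      (𝓝 (∫ t, f t ∂μ)) := by
  have hw := hweak f
  simp only [integral_empiricalSpectralMeasure] at hw
  suffices h : Tendsto (fun n => ∑ i, ‖eigenCoord (hA n) (v n) i‖ ^ 2 *
      f ((hA n).eigenvalues i) - (∑ i, f ((hA n).eigenvalues i)) / n) atTop (𝓝 0) by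
    simpa using h.add hw
  rw [Metric.tendsto_nhds]
  intro ε hε
  obtain ⟨p, hp⟩ := exists_polynomial_near_of_continuousOn (-R) R f f.continuous.continuousOn
    (ε / 3) (by linarith)
  have hpoly := tendsto_polynomial_sub hA hθ hR hdev p
  rw [Metric.tendsto_nhds] at hpoly
  filter_upwards [hpoly (ε / 3) (by linarith), hR, eventually_ge_atTop 1] with n hn hRn hn1
  have hnpos : (0 : ℝ) < n := by exact_mod_cast hn1
  rw [dist_zero_right, Real.norm_eq_abs] at hn ⊢
  set q : Fin n → ℝ := fun i => ‖eigenCoord (hA n) (v n) i‖ ^ 2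
  have hq : ∑ i, q i = 1 := (sum_norm_sq_eigenCoord (hA n) (v n)).trans (hv n hn1)
  set g : Fin n → ℝ := fun i => f ((hA n).eigenvalues i) - p.eval ((hA n).eigenvalues i)
  have hg : ∀ i, |g i| ≤ ε / 3 := fun i => by
    rw [abs_sub_comm]
    exact (hp _ (abs_le.1 (hRn i))).le
  have h1 : |∑ i, q i * g i| ≤ ε / 3 := by
    calc _ ≤ ∑ i, |q i * g i| := Finset.abs_sum_le_sum_abs _ _
      _ ≤ ∑ i, q i * (ε / 3) := Finset.sum_le_sum fun i _ => by
          have hqi : 0 ≤ q i := sq_nonneg _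
          rw [abs_mul, abs_of_nonneg hqi]
          gcongr
          exact hg i
      _ = _ := by rw [← Finset.sum_mul, hq, one_mul]
  have h2 : |(∑ i, g i) / n| ≤ ε / 3 := by
    rw [abs_div, abs_of_pos hnpos, div_le_iff₀ hnpos]
    calc _ ≤ ∑ i, |g i| := Finset.abs_sum_le_sum_abs _ _
      _ ≤ ∑ _i : Fin n, ε / 3 := Finset.sum_le_sum fun i _ => hg i
      _ = _ := by simp [mul_comm]
  have e : ∑ i, q i * f ((hA n).eigenvalues i) - (∑ i, f ((hA n).eigenvalues i)) / n =
      (∑ i, q i * p.eval ((hA n).eigenvalues i) - (∑ i, p.eval ((hA n).eigenvalues i)) / n) +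
        (∑ i, q i * g i - (∑ i, g i) / n) := by
    simp only [g, mul_sub, Finset.sum_sub_distrib]
    ring
  rw [e]
  have h3 := abs_add_le
    (∑ i, q i * p.eval ((hA n).eigenvalues i) - (∑ i, p.eval ((hA n).eigenvalues i)) / n)
    (∑ i, q i * g i - (∑ i, g i) / n)
  have h4 := abs_sub (∑ i, q i * g i) ((∑ i, g i) / n)
  linarith

end SpectralConvergence

/-! ### Extreme eigenvalues of a rank one multiplicative perturbation -/

section Comparison

variable {𝕜 : Type*} [RCLike 𝕜] {n : ℕ}

lemma eigenvalues_mem_realEigenvalues {A : Matrix (Fin n) (Fin n) 𝕜} (hA : A.IsHermitian)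
    (i : Fin n) : hA.eigenvalues i ∈ realEigenvalues A := by
  refine mem_realEigenvalues (v := (hA.eigenvectorBasis i).ofLp) ?_ ?_
  · simpa using hA.eigenvectorBasis.orthonormal.ne_zero i
  · rw [hA.mulVec_eigenvectorBasis]
    ext j
    simp [RCLike.real_smul_eq_coe_mul]

lemma le_maxEigenvalue {A : Matrix (Fin n) (Fin n) 𝕜} {t : ℝ} (ht : t ∈ realEigenvalues A) :
    t ≤ maxEigenvalue A :=
  le_csSup (finite_realEigenvalues A).bddAbove ht

lemma minEigenvalue_le {A : Matrix (Fin n) (Fin n) 𝕜} {t : ℝ} (ht : t ∈ realEigenvalues A) :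
    minEigenvalue A ≤ t :=
  csInf_le (finite_realEigenvalues A).bddBelow ht

lemma maxEigenvalue_mem {A : Matrix (Fin n) (Fin n) 𝕜} (hA : A.IsHermitian) (hn : 1 ≤ n) :
    maxEigenvalue A ∈ realEigenvalues A :=
  Set.Nonempty.csSup_mem ⟨_, eigenvalues_mem_realEigenvalues hA ⟨0, hn⟩⟩ (finite_realEigenvalues A)

lemma minEigenvalue_mem {A : Matrix (Fin n) (Fin n) 𝕜} (hA : A.IsHermitian) (hn : 1 ≤ n) :
    minEigenvalue A ∈ realEigenvalues A :=
  Set.Nonempty.csInf_mem ⟨_, eigenvalues_mem_realEigenvalues hA ⟨0, hn⟩⟩ (finite_realEigenvalues A)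

lemma nonneg_of_mem_realEigenvalues {A : Matrix (Fin n) (Fin n) 𝕜} (hA : A.PosSemidef) {t : ℝ}
    (ht : t ∈ realEigenvalues A) : 0 ≤ t := by
  obtain ⟨v, hv, hAv⟩ := exists_eigenvector_of_mem_realEigenvalues ht
  have h := hA.re_dotProduct_nonneg v
  rwa [hAv, dotProduct_smul, star_dotProduct_self, hv, smul_eq_mul, RCLike.re_ofReal_mul,
    RCLike.ofReal_one, RCLike.one_re, mul_one] at h

/-- The rank one update `1 + s v v*` of the identity. -/
noncomputable def rankOneUpdate (v : Fin n → 𝕜) (s : ℝ) : Matrix (Fin n) (Fin n) 𝕜 :=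
  1 + (s : 𝕜) • Matrix.vecMulVec v (star v)

lemma isHermitian_rankOneUpdate (v : Fin n → 𝕜) (s : ℝ) : (rankOneUpdate v s).IsHermitian := by
  unfold rankOneUpdate
  rw [Matrix.IsHermitian, Matrix.conjTranspose_add, Matrix.conjTranspose_one,
    Matrix.conjTranspose_smul, Matrix.conjTranspose_vecMulVec, star_star]
  simp

/-- On the line of `v` the factors `1 + s` and `1 + t` multiply, so square roots and inverses stay
within the family. -/
lemma rankOneUpdate_mul {v : Fin n → 𝕜} (hv : ∑ i, ‖v i‖ ^ 2 = 1) (s t : ℝ) :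
    rankOneUpdate v s * rankOneUpdate v t = rankOneUpdate v (s + t + s * t) := by
  unfold rankOneUpdate
  have h : Matrix.vecMulVec v (star v) * Matrix.vecMulVec v (star v) =
      Matrix.vecMulVec v (star v) := by
    rw [Matrix.vecMulVec_mul_vecMulVec, star_dotProduct_self, hv]
    simp
  rw [add_mul, mul_add, mul_add, one_mul, one_mul, mul_one, smul_mul_smul_comm, h]
  push_cast
  rw [add_smul, add_smul]
  abel

lemma quadForm_rankOneUpdate (v e : Fin n → 𝕜) (s : ℝ) :
    star e ⬝ᵥ (rankOneUpdate v s).mulVec e =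
      ((∑ i, ‖e i‖ ^ 2 + s * ‖star v ⬝ᵥ e‖ ^ 2 : ℝ) : 𝕜) := by
  unfold rankOneUpdate
  rw [Matrix.add_mulVec, Matrix.one_mulVec, dotProduct_add, star_dotProduct_self,
    Matrix.smul_mulVec, Matrix.vecMulVec_mulVec, dotProduct_smul, smul_eq_mul]
  have h : star e ⬝ᵥ v = star (star v ⬝ᵥ e) := Matrix.star_dotProduct _ _
  have h2 : star e ⬝ᵥ (MulOpposite.op (star v ⬝ᵥ e) • v) = ((‖star v ⬝ᵥ e‖ ^ 2 : ℝ) : 𝕜) := by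
    rw [dotProduct_smul, h, MulOpposite.smul_eq_mul_unop, MulOpposite.unop_op, RCLike.star_def,
      RCLike.conj_mul]
    norm_cast
  rw [h2]
  push_cast
  ring

/-- `A (1 + θ v v*)` is similar to a Hermitian matrix `H`, and an eigenvector of `A` yields a test
vector for `H` whose length is controlled. -/
lemma exists_hermitian_similar {A : Matrix (Fin n) (Fin n) 𝕜} (hA : A.IsHermitian)
    {v : Fin n → 𝕜} (hv : ∑ i, ‖v i‖ ^ 2 = 1) {θ : ℝ} (hθ : -1 < θ) {t : ℝ}
    (ht : t ∈ realEigenvalues A) :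
    ∃ (H : Matrix (Fin n) (Fin n) 𝕜) (hH : H.IsHermitian) (w : Fin n → ℝ) (r : ℝ),
      (∀ i, hH.eigenvalues i ∈ realEigenvalues (A * rankOneUpdate v θ)) ∧ (∀ i, 0 ≤ w i) ∧
      (∃ i, 0 < w i) ∧ 0 ≤ r ∧ ∑ i, w i = 1 + (1 / (1 + θ) - 1) * r ∧
      t = ∑ i, hH.eigenvalues i * w i := by
  obtain ⟨e, he, hAe⟩ := exists_eigenvector_of_mem_realEigenvalues ht
  -- `S` is the square root of `1 + θ v v*` and `S'` is its inverse. With `H = S A S` and the test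
  -- vector `S' e`, the quadratic form of `H` is that of `A` at `e`, namely `t`, and the squared
  -- length is the form of `(1 + θ v v*)⁻¹` at `e`.
  set c := √(1 + θ) with hc
  have hc0 : 0 < c := Real.sqrt_pos.2 (by linarith)
  have hc2 : c ^ 2 = 1 + θ := Real.sq_sqrt (by linarith)
  set S := rankOneUpdate v (c - 1) with hS
  set S' := rankOneUpdate v (c⁻¹ - 1) with hS'
  have h1 : rankOneUpdate v 0 = 1 := by simp [rankOneUpdate]
  have hSS' : S * S' = 1 := by
    rw [hS, hS', rankOneUpdate_mul hv, ← h1]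
    congr 1
    field_simp
    ring
  have hS'S : S' * S = 1 := by
    rw [hS, hS', rankOneUpdate_mul hv, ← h1]
    congr 1
    field_simp
    ring
  have hSS : S * S = rankOneUpdate v θ := by
    rw [hS, rankOneUpdate_mul hv]
    congr 1
    linarith [hc2]
  have hS'2 : S' * S' = rankOneUpdate v (1 / (1 + θ) - 1) := by
    rw [hS', rankOneUpdate_mul hv, ← hc2]
    congr 1
    field_simp
    ring
  have hSh : S.conjTranspose = S := isHermitian_rankOneUpdate v _
  have hS'h : S'.conjTranspose = S' := isHermitian_rankOneUpdate v _
  have hH : (S * A * S).IsHermitian := by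
    have := Matrix.isHermitian_mul_mul_conjTranspose S hA
    rwa [hSh] at this
  have hSf : S.mulVec (S'.mulVec e) = e := by
    rw [Matrix.mulVec_mulVec, hSS', Matrix.one_mulVec]
  refine ⟨S * A * S, hH, fun i => ‖eigenCoord hH (S'.mulVec e) i‖ ^ 2, ‖star v ⬝ᵥ e‖ ^ 2,
    fun i => ?_, fun i => sq_nonneg _, ?_, sq_nonneg _, ?_, ?_⟩
  · obtain ⟨w, hw, hHw⟩ := exists_eigenvector_of_mem_realEigenvalues
      (eigenvalues_mem_realEigenvalues hH i)
    have hSw : S.mulVec (S'.mulVec w) = w := by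
      rw [Matrix.mulVec_mulVec, hSS', Matrix.one_mulVec]
    refine mem_realEigenvalues (v := S'.mulVec w) (fun h0 => ?_) ?_
    · rw [h0, Matrix.mulVec_zero] at hSw
      exact ne_zero_of_sum_norm_sq hw hSw.symm
    · rw [← Matrix.mulVec_smul, ← hHw, Matrix.mulVec_mulVec, Matrix.mulVec_mulVec, ← hSS]
      congr 1
      calc A * (S * S) * S' = A * (S * (S * S')) := by simp only [mul_assoc]
        _ = (S' * S) * A * S := by rw [hSS', hS'S, mul_one, one_mul]
        _ = _ := by simp only [mul_assoc]
  · by_contra! hle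
    have hsum := sum_norm_sq_eigenCoord hH (S'.mulVec e)
    have h0 : ∑ i, ‖S'.mulVec e i‖ ^ 2 ≤ 0 := by
      rw [← hsum]
      exact Finset.sum_nonpos fun i _ => hle i
    have h00 : S'.mulVec e = 0 := by
      have := (Finset.sum_eq_zero_iff_of_nonneg fun i _ => sq_nonneg ‖S'.mulVec e i‖).1
        (le_antisymm h0 (Finset.sum_nonneg fun i _ => sq_nonneg _))
      ext i
      simpa using this i (Finset.mem_univ i)
    rw [h00, Matrix.mulVec_zero] at hSf
    exact ne_zero_of_sum_norm_sq he hSf.symm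
  · rw [sum_norm_sq_eigenCoord]
    have h := star_dotProduct_self (S'.mulVec e)
    rw [Matrix.star_mulVec, hS'h, ← Matrix.dotProduct_mulVec, Matrix.mulVec_mulVec, hS'2,
      quadForm_rankOneUpdate, he] at h
    exact_mod_cast h.symm
  · have hvec : Matrix.vecMul (star (S'.mulVec e)) S = star e := by
      have := Matrix.star_mulVec S (S'.mulVec e)
      rwa [hSh, hSf, eq_comm] at this
    have h := star_dotProduct_pow_mulVec hH (S'.mulVec e) 1
    rw [pow_one, ← Matrix.mulVec_mulVec, hSf, ← Matrix.mulVec_mulVec, hAe, Matrix.mulVec_smul,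
      dotProduct_smul, Matrix.dotProduct_mulVec, hvec,
      star_dotProduct_self, he] at h
    simp only [pow_one] at h
    have h' : ((t : ℝ) : 𝕜) = ((∑ i, hH.eigenvalues i * ‖eigenCoord hH (S'.mulVec e) i‖ ^ 2 : ℝ)
      : 𝕜) := by
      rw [← h]
      simp
    exact_mod_cast h'

lemma sum_mul_lt_of_forall_lt {h w : Fin n → ℝ} {t : ℝ} (hw : ∀ i, 0 ≤ w i)
    (hw' : ∃ i, 0 < w i) (hlt : ∀ i, h i < t) : ∑ i, h i * w i < t * ∑ i, w i := by
  obtain ⟨i, hi⟩ := hw'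
  rw [Finset.mul_sum]
  exact Finset.sum_lt_sum (fun j _ => mul_le_mul_of_nonneg_right (hlt j).le (hw j))
    ⟨i, Finset.mem_univ i, mul_lt_mul_of_pos_right (hlt i) hi⟩

/-- For `θ > 0` the test vector has length at most 1. If all eigenvalues of `H` were below `t =
maxEigenvalue A ≥ 0`, its quadratic form would be below `t`, whereas it equals `t`. -/
lemma maxEigenvalue_le_perturbed {A : Matrix (Fin n) (Fin n) 𝕜} (hA : A.PosSemidef)
    (hn : 1 ≤ n) {v : Fin n → 𝕜} (hv : ∑ i, ‖v i‖ ^ 2 = 1) {θ : ℝ} (hθ : 0 < θ) :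
    maxEigenvalue A ≤ maxEigenvalue (A * rankOneUpdate v θ) := by
  have hmem := maxEigenvalue_mem hA.isHermitian hn
  have h0 := nonneg_of_mem_realEigenvalues hA hmem
  obtain ⟨H, hH, w, r, hev, hw, hw', hr, hsum, ht⟩ :=
    exists_hermitian_similar (θ := θ) hA.isHermitian hv (by linarith) hmem
  by_contra! hlt
  have h := sum_mul_lt_of_forall_lt (h := hH.eigenvalues) (t := maxEigenvalue A) hw hw'
    fun i => (le_maxEigenvalue (hev i)).trans_lt hlt
  rw [← ht, hsum] at h
  have h1 : 1 / (1 + θ) - 1 ≤ 0 := by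
    rw [sub_nonpos, div_le_one (by linarith)]
    linarith
  nlinarith [mul_nonneg h0 (mul_nonneg (neg_nonneg.2 h1) hr)]

/-- For `θ < 0` the test vector has length at least 1, which reverses the comparison. -/
lemma perturbed_minEigenvalue_le {A : Matrix (Fin n) (Fin n) 𝕜} (hA : A.PosSemidef)
    (hn : 1 ≤ n) {v : Fin n → 𝕜} (hv : ∑ i, ‖v i‖ ^ 2 = 1) {θ : ℝ} (hθ : -1 < θ) (hθ0 : θ < 0) :
    minEigenvalue (A * rankOneUpdate v θ) ≤ minEigenvalue A := by
  have hmem := minEigenvalue_mem hA.isHermitian hn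
  have h0 := nonneg_of_mem_realEigenvalues hA hmem
  obtain ⟨H, hH, w, r, hev, hw, hw', hr, hsum, ht⟩ :=
    exists_hermitian_similar hA.isHermitian hv hθ hmem
  by_contra! hlt
  have h := sum_mul_lt_of_forall_lt (h := fun i => -hH.eigenvalues i) (t := -minEigenvalue A)
    hw hw' fun i => neg_lt_neg (hlt.trans_le (minEigenvalue_le (hev i)))
  simp only [neg_mul, Finset.sum_neg_distrib] at h
  rw [← ht, hsum] at h
  have h1 : 0 ≤ 1 / (1 + θ) - 1 := by
    rw [sub_nonneg, le_div_iff₀ (by linarith)]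
    linarith
  nlinarith [mul_nonneg h0 (mul_nonneg h1 hr)]

lemma projNorm_kerShift {θ : ℝ} (hθ : θ ≠ 0) {v : Fin n → 𝕜} (hv : ∑ i, ‖v i‖ ^ 2 = 1)
    (u : EuclideanSpace 𝕜 (Fin n)) :
    projNorm u (kerShift θ ((θ : 𝕜) • Matrix.vecMulVec v (star v))) = ‖star v ⬝ᵥ u.ofLp‖ := by
  have hθ' : (θ : 𝕜) ≠ 0 := by exact_mod_cast hθ
  have hnorm : ‖WithLp.toLp 2 v‖ = 1 := by
    rw [EuclideanSpace.norm_eq]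
    simp [hv]
  have hker : kerShift θ ((θ : 𝕜) • Matrix.vecMulVec v (star v)) =
      Submodule.span 𝕜 {WithLp.toLp 2 v} := by
    have hmul : ∀ x : Fin n → 𝕜, ((θ : 𝕜) • (1 : Matrix (Fin n) (Fin n) 𝕜) -
        (θ : 𝕜) • Matrix.vecMulVec v (star v)).mulVec x =
        (θ : 𝕜) • (x - (star v ⬝ᵥ x) • v) := fun x => by
      rw [Matrix.sub_mulVec, Matrix.smul_mulVec, Matrix.smul_mulVec, Matrix.one_mulVec,
        Matrix.vecMulVec_mulVec, smul_sub, op_smul_eq_smul]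
    ext x
    rw [kerShift, LinearMap.mem_ker, Submodule.mem_span_singleton]
    have hx : Matrix.toEuclideanLin ((θ : 𝕜) • (1 : Matrix (Fin n) (Fin n) 𝕜) -
        (θ : 𝕜) • Matrix.vecMulVec v (star v)) x =
        WithLp.toLp 2 ((θ : 𝕜) • (x.ofLp - (star v ⬝ᵥ x.ofLp) • v)) := by
      rw [← hmul]; rfl
    rw [hx, WithLp.toLp_eq_zero, smul_eq_zero_iff_right hθ', sub_eq_zero]
    constructor
    · intro h
      exact ⟨star v ⬝ᵥ x.ofLp, by rw [← WithLp.toLp_smul, ← h]⟩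
    · rintro ⟨d, rfl⟩
      simp [dotProduct_smul, star_dotProduct_self, hv]
  rw [projNorm, hker, Submodule.starProjection_unit_singleton 𝕜 hnorm, norm_smul, hnorm, mul_one]
  congr 1
  rw [EuclideanSpace.inner_eq_star_dotProduct, dotProduct_comm]

/-- The eigenvector equation in the eigenbasis of `A`. -/
lemma eigenvector_equation {A : Matrix (Fin n) (Fin n) 𝕜} (hA : A.IsHermitian) {v : Fin n → 𝕜}
    {θ z : ℝ} {u : EuclideanSpace 𝕜 (Fin n)}
    (hu : IsUnitEigenvector (A * (1 + (θ : 𝕜) • Matrix.vecMulVec v (star v))) z u) (i : Fin n) :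
    ((z - hA.eigenvalues i : ℝ) : 𝕜) * eigenCoord hA u.ofLp i =
      ((θ * hA.eigenvalues i : ℝ) : 𝕜) * (star v ⬝ᵥ u.ofLp) * eigenCoord hA v i := by
  have h := congrArg WithLp.ofLp hu.2.apply_eq_smul
  have h1 : (A * (1 + (θ : 𝕜) • Matrix.vecMulVec v (star v))).mulVec u.ofLp = (z : 𝕜) • u.ofLp := h
  rw [← Matrix.mulVec_mulVec, Matrix.add_mulVec, Matrix.one_mulVec, Matrix.smul_mulVec,
    Matrix.vecMulVec_mulVec, op_smul_eq_smul] at h1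
  have h2 := congrArg (fun w => eigenCoord hA w i) h1
  simp only [eigenCoord_mulVec] at h2
  have hadd : ∀ x y : Fin n → 𝕜, eigenCoord hA (x + y) = eigenCoord hA x + eigenCoord hA y :=
    fun x y => Matrix.mulVec_add _ _ _
  have hsmul : ∀ (d : 𝕜) (x : Fin n → 𝕜), eigenCoord hA (d • x) = d • eigenCoord hA x :=
    fun d x => Matrix.mulVec_smul _ _ _
  rw [hadd, hsmul, hsmul, hsmul] at h2
  simp only [Pi.add_apply, Pi.smul_apply, smul_eq_mul] at h2
  push_cast
  linear_combination -h2

lemma sum_norm_sq_of_isUnitEigenvector {B : Matrix (Fin n) (Fin n) 𝕜} {z : ℝ}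
    {u : EuclideanSpace 𝕜 (Fin n)} (hu : IsUnitEigenvector B z u) : ∑ i, ‖u.ofLp i‖ ^ 2 = 1 := by
  have := EuclideanSpace.norm_sq_eq u
  rw [hu.1, one_pow] at this
  exact this.symm

end Comparison

/-! ### The subcritical condition at the edge -/

section Subcritical

variable {μ : Measure ℝ} {a b θ : ℝ} {Ta Tb : EReal}

lemma not_ae_eq_zero [IsProbabilityMeasure μ] (hμ : μ ≠ Measure.dirac 0) : ¬ ∀ᵐ t ∂μ, t = 0 := by
  intro h
  refine hμ ?_
  have h1 : μ.map id = μ.map fun _ => (0 : ℝ) := Measure.map_congr h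
  rwa [Measure.map_id, Measure.map_const, measure_univ, one_smul] at h1

lemma edge_limit_left_nonpos (ha : ∀ᵐ t ∂μ, a ≤ t) (hpos : ∀ᵐ t ∂μ, 0 ≤ t)
    (hTa : Tendsto (fun z => (tTransform μ z : EReal)) (𝓝[<] a) (𝓝 Ta)) : Ta ≤ 0 := by
  refine le_of_tendsto hTa ?_
  filter_upwards [self_mem_nhdsWithin] with z hz
  have : tTransform μ z ≤ 0 := integral_nonpos_of_ae (by
    filter_upwards [ha, hpos] with t hat h0
    exact div_nonpos_of_nonneg_of_nonpos h0 (by linarith [Set.mem_Iio.1 hz]))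
  exact_mod_cast this

lemma edge_limit_right_nonneg (hb : ∀ᵐ t ∂μ, t ≤ b) (hpos : ∀ᵐ t ∂μ, 0 ≤ t)
    (hTb : Tendsto (fun z => (tTransform μ z : EReal)) (𝓝[>] b) (𝓝 Tb)) : 0 ≤ Tb := by
  refine ge_of_tendsto hTb ?_
  filter_upwards [self_mem_nhdsWithin] with z hz
  have : 0 ≤ tTransform μ z := integral_nonneg_of_ae (by
    filter_upwards [hb, hpos] with t hbt h0
    exact div_nonneg h0 (by linarith [Set.mem_Ioi.1 hz]))
  exact_mod_cast this

/-- If `θ T(z) ≥ 1` at some `z > b`, strict monotonicity gives `T > 1 / θ` at the midpoint of `b`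
and `z`, hence `T(b⁺) > 1 / θ`. As `T(a⁻) ≤ 0 < 1 / θ`, the point `1 / θ` would lie in the excluded
interval. -/
lemma subcritical_right [IsProbabilityMeasure μ] (ha : ∀ᵐ t ∂μ, a ≤ t) (hb : ∀ᵐ t ∂μ, t ≤ b) (hpos : ∀ᵐ t ∂μ, 0 ≤ t)
    (hμ : μ ≠ Measure.dirac 0) (hθ : 0 < θ)
    (hTa : Tendsto (fun z => (tTransform μ z : EReal)) (𝓝[<] a) (𝓝 Ta))
    (hTb : Tendsto (fun z => (tTransform μ z : EReal)) (𝓝[>] b) (𝓝 Tb))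
    (hsub : ((1 / θ : ℝ) : EReal) ∉ Set.Ioo Ta Tb) {z : ℝ} (hz : b < z) :
    θ * tTransform μ z < 1 := by
  by_contra! hge
  have hanti : ∀ {x y : ℝ}, b < x → x < y → θ * tTransform μ y < θ * tTransform μ x :=
    fun hx hxy => tTransform_strictAnti hb (hpos.mono fun t ht => mul_nonneg hθ.le ht)
      (not_ae_eq_zero hμ) hθ.ne' hx hxy
  have h1 := hanti (x := (b + z) / 2) (y := z) (by linarith) (by linarith)
  refine hsub ⟨(edge_limit_left_nonpos ha hpos hTa).trans_lt ?_, ?_⟩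
  · have : 0 < 1 / θ := by positivity
    exact_mod_cast this
  · have h2 : 1 / θ < tTransform μ ((b + z) / 2) := by
      rw [div_lt_iff₀ hθ]
      linarith
    refine lt_of_lt_of_le (EReal.coe_lt_coe_iff.2 h2) (ge_of_tendsto hTb ?_)
    filter_upwards [Ioo_mem_nhdsGT (show b < (b + z) / 2 by linarith)] with x hx
    exact EReal.coe_le_coe_iff.2 (lt_of_mul_lt_mul_left (hanti hx.1 hx.2) hθ.le).le

lemma subcritical_left [IsProbabilityMeasure μ] (ha : ∀ᵐ t ∂μ, a ≤ t) (hb : ∀ᵐ t ∂μ, t ≤ b) (hpos : ∀ᵐ t ∂μ, 0 ≤ t)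
    (hμ : μ ≠ Measure.dirac 0) (hθ : θ < 0)
    (hTa : Tendsto (fun z => (tTransform μ z : EReal)) (𝓝[<] a) (𝓝 Ta))
    (hTb : Tendsto (fun z => (tTransform μ z : EReal)) (𝓝[>] b) (𝓝 Tb))
    (hsub : ((1 / θ : ℝ) : EReal) ∉ Set.Ioo Ta Tb) {z : ℝ} (hz : -a < z) :
    θ * tTransform (μ.map fun t => -t) z < 1 := by
  by_contra! hge
  have hneg : Measurable fun t : ℝ => -t := measurable_neg
  have : IsProbabilityMeasure (μ.map fun t => -t) := Measure.isProbabilityMeasure_map hneg.aemeasurable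
  have hne : ¬ ∀ᵐ t ∂(μ.map fun t : ℝ => -t), t = 0 := by
    intro h
    have h' := (ae_map_iff hneg.aemeasurable (measurableSet_singleton (0 : ℝ))).1 h
    exact not_ae_eq_zero hμ (h'.mono fun t ht => neg_eq_zero.1 ht)
  have hanti : ∀ {x y : ℝ}, -a < x → x < y →
      θ * tTransform (μ.map fun t => -t) y < θ * tTransform (μ.map fun t => -t) x :=
    fun hx hxy => tTransform_strictAnti (β := -a)
      ((ae_map_iff hneg.aemeasurable measurableSet_Iic).2 (ha.mono fun t ht => neg_le_neg ht))
      ((ae_map_iff hneg.aemeasurable (measurableSet_le measurable_const (by fun_prop))).2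
        (hpos.mono fun t ht => by nlinarith)) hne hθ.ne hx hxy
  have h1 := hanti (x := (-a + z) / 2) (y := z) (by linarith) (by linarith)
  refine hsub ⟨?_, lt_of_lt_of_le ?_ (edge_limit_right_nonneg hb hpos hTb)⟩
  · have h2 : tTransform μ (-((-a + z) / 2)) < 1 / θ := by
      rw [lt_div_iff_of_neg hθ, ← tTransform_map_neg]
      linarith
    refine lt_of_le_of_lt (le_of_tendsto hTa ?_) (EReal.coe_lt_coe_iff.2 h2)
    filter_upwards [Ioo_mem_nhdsLT (show -((-a + z) / 2) < a by linarith)] with x hx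
    have h3 := hanti (x := -x) (y := (-a + z) / 2) (by linarith [hx.2]) (by linarith [hx.1])
    rw [tTransform_map_neg, tTransform_map_neg, neg_neg] at h3
    exact EReal.coe_le_coe_iff.2 (lt_of_mul_lt_mul_of_nonpos_left h3 hθ.le).le
  · have : 1 / θ < 0 := one_div_neg.2 hθ
    exact_mod_cast this

end Subcritical

/-! ### Delocalisation of the extreme eigenvector -/

lemma tendsto_overlap {𝕜 : Type*} [RCLike 𝕜] {X : (n : ℕ) → Matrix (Fin n) (Fin n) 𝕜}
    (hX : ∀ n, (X n).PosSemidef) {v : (n : ℕ) → Fin n → 𝕜}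
    (hv : ∀ n, 1 ≤ n → ∑ i, ‖v n i‖ ^ 2 = 1) {θ : ℝ} (hθ : θ ≠ 0) (hθ1 : -1 < θ)
    {μ : Measure ℝ} [IsProbabilityMeasure μ] (hμ : μ ≠ Measure.dirac 0) {a b : ℝ}
    (ha : ∀ᵐ t ∂μ, a ≤ t) (hb : ∀ᵐ t ∂μ, t ≤ b)
    (hdev : ∀ k, Tendsto (fun n => traceDeviation θ k (X n)
      ((θ : 𝕜) • Matrix.vecMulVec (v n) (star (v n)))) atTop (𝓝 0))
    (hweak : WeaklyConverges (fun n => empiricalSpectralMeasure (hX n).isHermitian) μ)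
    (hmin : Tendsto (fun n => minEigenvalue (X n)) atTop (𝓝 a))
    (hmax : Tendsto (fun n => maxEigenvalue (X n)) atTop (𝓝 b))
    {Ta Tb : EReal}
    (hTa : Tendsto (fun z => (tTransform μ z : EReal)) (𝓝[<] a) (𝓝 Ta))
    (hTb : Tendsto (fun z => (tTransform μ z : EReal)) (𝓝[>] b) (𝓝 Tb))
    (hsub : ((1 / θ : ℝ) : EReal) ∉ Set.Ioo Ta Tb)
    (hderivb : 0 < θ → Tendsto (deriv (tTransform μ)) (𝓝[>] b) atBot)
    (hderiva : θ < 0 → Tendsto (deriv (tTransform μ)) (𝓝[<] a) atBot)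
    (hatom : θ < 0 → μ {0} = 0)
    {u : (n : ℕ) → EuclideanSpace 𝕜 (Fin n)}
    (hu : ∀ n, 1 ≤ n → IsUnitEigenvector
      (X n * (1 + (θ : 𝕜) • Matrix.vecMulVec (v n) (star (v n))))
      (if 0 < θ then maxEigenvalue (X n * (1 + (θ : 𝕜) • Matrix.vecMulVec (v n) (star (v n))))
        else minEigenvalue (X n * (1 + (θ : 𝕜) • Matrix.vecMulVec (v n) (star (v n))))) (u n)) :
    Tendsto (fun n => ‖star (v n) ⬝ᵥ (u n).ofLp‖) atTop (𝓝 0) := by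
  have hXh := fun n => (hX n).isHermitian
  have hle : ∀ n i, (hXh n).eigenvalues i ≤ maxEigenvalue (X n) := fun n i =>
    le_maxEigenvalue (eigenvalues_mem_realEigenvalues (hXh n) i)
  have hge : ∀ n i, minEigenvalue (X n) ≤ (hXh n).eigenvalues i := fun n i =>
    minEigenvalue_le (eigenvalues_mem_realEigenvalues (hXh n) i)
  have hnn : ∀ n i, 0 ≤ (hXh n).eigenvalues i := fun n i => (hX n).eigenvalues_nonneg i
  have ha0 : 0 ≤ a := ge_of_tendsto hmin (by
    filter_upwards [eventually_ge_atTop 1] with n hn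
    exact nonneg_of_mem_realEigenvalues (hX n) (minEigenvalue_mem (hXh n) hn))
  have hpos : ∀ᵐ t ∂μ, 0 ≤ t := ha.mono fun t ht => ha0.trans ht
  have hR : ∀ᶠ n in atTop, ∀ i, |(hXh n).eigenvalues i| ≤ b + 1 := by
    filter_upwards [hmax.eventually_le_const (show b < b + 1 by linarith)] with n hn i
    rw [abs_of_nonneg (hnn n i)]
    exact (hle n i).trans hn
  have hconv := tendsto_weighted_spectral hXh hθ hv hR hdev hweak
  have hc : ∀ n, 1 ≤ n → star (v n) ⬝ᵥ (u n).ofLp =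
      ∑ i, star (eigenCoord (hXh n) (v n) i) * eigenCoord (hXh n) (u n).ofLp i := fun n _ =>
    (star_dotProduct_eigenCoord (hXh n) _ _).symm
  have hu1 : ∀ n, 1 ≤ n → ∑ i, ‖eigenCoord (hXh n) (u n).ofLp i‖ ^ 2 = 1 := fun n hn =>
    (sum_norm_sq_eigenCoord _ _).trans (sum_norm_sq_of_isUnitEigenvector (hu n hn))
  have hv1 : ∀ n, 1 ≤ n → ∑ i, ‖eigenCoord (hXh n) (v n) i‖ ^ 2 = 1 := fun n hn =>
    (sum_norm_sq_eigenCoord _ _).trans (hv n hn)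
  have heq := fun n hn => eigenvector_equation (hXh n) (hu n hn)
  rcases lt_or_gt_of_ne hθ with hneg | hθpos
  · simp only [if_neg hneg.not_gt] at heq
    have hzle : ∀ n, 1 ≤ n →
        minEigenvalue (X n * (1 + (θ : 𝕜) • Matrix.vecMulVec (v n) (star (v n)))) ≤
          minEigenvalue (X n) := fun n hn => perturbed_minEigenvalue_le (hX n) hn (hv n hn) hθ1 hneg
    -- The divergence lemma needs a nonzero edge, so `a = 0` is handled by the absence of an atom.
    rcases ha0.eq_or_lt with h0 | hapos
    · refine tendsto_overlap_of_edge_zero hneg hθ1 hconv hpos (hatom hneg) hc hu1 hv1 heq ?_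
      intro ε hε
      filter_upwards [hmin.eventually_le_const (show a < ε by linarith), eventually_ge_atTop 1]
        with n hn hn1
      exact (hzle n hn1).trans hn
    · have hmneg : Measurable fun t : ℝ => -t := measurable_neg
      have : IsProbabilityMeasure (μ.map fun t => -t) :=
        Measure.isProbabilityMeasure_map hmneg.aemeasurable
      have hβ : ∀ᵐ t ∂(μ.map fun t => -t), t ≤ -a :=
        (ae_map_iff hmneg.aemeasurable measurableSet_Iic).2 (ha.mono fun t ht => neg_le_neg ht)
      -- Negating eigenvalues and spectral parameter changes the sign of both sides of the
      -- eigenvector equation and leaves `θ` and the overlap unchanged, so the lower edge `a`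
      -- becomes the upper edge `-a`.
      refine tendsto_overlap_of_edge (ν := μ.map fun t => -t) (β := -a)
        (x := fun n i => -(hXh n).eigenvalues i)
        (y := fun n => -minEigenvalue (X n * (1 + (θ : 𝕜) • Matrix.vecMulVec (v n) (star (v n)))))
        hθ ?_ hβ hc hu1 ?_ ?_ ?_ ?_
        (fun z hz => subcritical_left ha hb hpos hμ hneg hTa hTb hsub hz)
        (exists_lt_integral_sq_div_sub (M := b) hβ ?_ (by linarith) ?_)
      · intro f
        rw [integral_map hmneg.aemeasurable f.continuous.aestronglyMeasurable]
        exact hconv (f.compContinuous ⟨fun t => -t, continuous_neg⟩)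
      · intro n hn i
        have := heq n hn i
        push_cast at this ⊢
        linear_combination -this
      · intro n i
        have := hnn n i
        nlinarith
      · intro ε hε
        filter_upwards [hmin.eventually_const_le (show a - ε < a by linarith)] with n hn i
        linarith [hge n i]
      · intro ε hε
        filter_upwards [hmin.eventually_le_const (show a < a + ε by linarith),
          eventually_ge_atTop 1] with n hn hn1
        linarith [hzle n hn1]
      · refine (ae_map_iff hmneg.aemeasurable
          (measurableSet_le (by fun_prop) measurable_const)).2 ?_
        filter_upwards [hb, hpos] with t ht h0
        rwa [abs_neg, abs_of_nonneg h0]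
      · have e : tTransform (μ.map fun t => -t) = fun z => tTransform μ (-z) :=
          funext fun z => tTransform_map_neg μ z
        have hlim : Tendsto (fun z : ℝ => -z) (𝓝[>] (-a)) (𝓝[<] a) := by
          simpa using tendsto_neg_nhdsGT (a := -a)
        simp_rw [e, deriv_comp_neg, abs_neg]
        exact tendsto_abs_atBot_atTop.comp ((hderiva hneg).comp hlim)
  · simp only [if_pos hθpos] at heq
    have hb0 : b ≠ 0 := by
      rintro rfl
      exact not_ae_eq_zero hμ (by filter_upwards [hb, hpos] with t h1 h2; exact le_antisymm h1 h2)
    refine tendsto_overlap_of_edge hθ hconv hb hc hu1 heq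
      (fun n i => mul_nonneg hθpos.le (hnn n i)) ?_ ?_
      (fun z hz => subcritical_right ha hb hpos hμ hθpos hTa hTb hsub hz)
      (exists_lt_integral_sq_div_sub (M := b) hb ?_ hb0
        (tendsto_abs_atBot_atTop.comp (hderivb hθpos)))
    · intro ε hε
      filter_upwards [hmax.eventually_le_const (show b < b + ε by linarith)] with n hn i
      exact (hle n i).trans hn
    · intro ε hε
      filter_upwards [hmax.eventually_const_le (show b - ε < b by linarith),
        eventually_ge_atTop 1] with n hn hn1
      exact hn.trans (maxEigenvalue_le_perturbed (hX n) hn1 (hv n hn1) hθpos)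
    · filter_upwards [hb, hpos] with t ht h0
      rwa [abs_of_nonneg h0]

theorem theorem2p8
    {𝕜 : Type*} [RCLike 𝕜]
    {Ω : Type*} [MeasurableSpace Ω] (Pr : Measure Ω) [IsProbabilityMeasure Pr]
    -- the random matrices
    (X P : (n : ℕ) → Ω → Matrix (Fin n) (Fin n) 𝕜)
    (hXmeas : ∀ n, Measurable (X n)) (hPmeas : ∀ n, Measurable (P n))
    (hX : ∀ n ω, (X n ω).PosSemidef)
    -- `P n` is Hermitian of rank one with sole nonzero eigenvalue `θ`
    (θ : ℝ) (hθ : θ ≠ 0)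
    (hP : ∀ n ω, (P n ω).IsHermitian)
    (hPrank : ∀ n, 1 ≤ n → ∀ ω, (P n ω).rank = 1)
    (hPeig : ∀ n, 1 ≤ n → ∀ ω, θ ∈ realEigenvalues (P n ω))
    (hindep : ∀ n, IndepFun (X n) (P n) Pr)
    (hinv : ∀ n, ConjInvariant Pr (X n) ∨ ConjInvariant Pr (P n))
    -- the limiting eigenvalue distribution
    (μX : Measure ℝ) [IsProbabilityMeasure μX] (hcompact : IsCompact μX.support)
    (hμX : μX ≠ Measure.dirac 0)
    (a b : ℝ) (ha : IsLeast μX.support a) (hb : IsGreatest μX.support b)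
    (hweak : ∀ᵐ ω ∂Pr, WeaklyConverges (fun n => empiricalSpectralMeasure (hX n ω).isHermitian) μX)
    (hmin : ∀ᵐ ω ∂Pr, Tendsto (fun n => minEigenvalue (X n ω)) atTop (𝓝 a))
    (hmax : ∀ᵐ ω ∂Pr, Tendsto (fun n => maxEigenvalue (X n ω)) atTop (𝓝 b))
    -- the one-sided limits `T(a⁻)` and `T(b⁺)`, possibly infinite
    (Ta Tb : EReal)
    (hTa : Tendsto (fun z => (tTransform μX z : EReal)) (𝓝[<] a) (𝓝 Ta))
    (hTb : Tendsto (fun z => (tTransform μX z : EReal)) (𝓝[>] b) (𝓝 Tb))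
    -- subcritical perturbation, and infinite derivative at the relevant edge
    (hsub : ((1 / θ : ℝ) : EReal) ∉ Set.Ioo Ta Tb)
    (hderivb : 0 < θ → Tendsto (deriv (tTransform μX)) (𝓝[>] b) atBot)
    (hderiva : θ < 0 → Tendsto (deriv (tTransform μX)) (𝓝[<] a) atBot)
    -- `I + P n` is positive definite, and for `θ < 0` the limit has no atom at zero
    (hθ1 : -1 < θ) (hatom : θ < 0 → μX {0} = 0) :
    ∀ᵐ ω ∂Pr, ∀ u : (n : ℕ) → EuclideanSpace 𝕜 (Fin n),
      (∀ n, 1 ≤ n → IsUnitEigenvector (X n ω * (1 + P n ω))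
        (if 0 < θ then maxEigenvalue (X n ω * (1 + P n ω))
          else minEigenvalue (X n ω * (1 + P n ω))) (u n)) →
      Tendsto (fun n => projNorm (u n) (kerShift θ (P n ω))) atTop (𝓝 0) := by
  have hdev := ae_tendsto_traceDeviation hXmeas hPmeas hindep hinv hθ
    (fun n ω => (hX n ω).isHermitian) hP hPrank hPeig
  -- The exceptional null set is fixed before `u` is chosen; from here on everything is
  -- deterministic.
  filter_upwards [hweak, hmin, hmax, hdev] with ω hw hmn hmx hd u hu
  have hex : ∀ n, ∃ v : Fin n → 𝕜, 1 ≤ n →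
      ∑ i, ‖v i‖ ^ 2 = 1 ∧ P n ω = (θ : 𝕜) • Matrix.vecMulVec v (star v) := fun n => by
    by_cases hn : 1 ≤ n
    · obtain ⟨v, hv⟩ := exists_eq_smul_vecMulVec (hP n ω) (hPrank n hn ω) hθ (hPeig n hn ω)
      exact ⟨v, fun _ => hv⟩
    · exact ⟨0, fun h => absurd h hn⟩
  choose v hv using hex
  have hsupp : ∀ᵐ t ∂μX, t ∈ μX.support := Measure.support_mem_ae
  have hlim : Tendsto (fun n => ‖star (v n) ⬝ᵥ (u n).ofLp‖) atTop (𝓝 0) := by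
    refine tendsto_overlap (fun n => hX n ω) (fun n hn => (hv n hn).1) hθ hθ1 hμX
      (hsupp.mono fun t ht => ha.2 ht) (hsupp.mono fun t ht => hb.2 ht) (fun k => (hd k).congr' ?_) hw hmn hmx
      hTa hTb hsub hderivb hderiva hatom fun n hn => ?_
    · filter_upwards [eventually_ge_atTop 1] with n hn
      rw [(hv n hn).2]
    · rw [← (hv n hn).2]
      exact hu n hn
  refine hlim.congr' ?_
  filter_upwards [eventually_ge_atTop 1] with n hn
  rw [(hv n hn).2, projNorm_kerShift hθ (hv n hn).1]
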